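/- Let $1<p<\infty$, let $\Omega\subset\mathbb{R}^n$ be an open set, let $T>0$ and $\Omega_T=\Omega\times(0,T)$. A function $u\in L^p_{\mathrm{loc}}(0,T;W^{1,p}_{\mathrm{loc}}(\Omega))$ is called a weak subsolution of $\partial_t(|u|^{p-2}u)=\operatorname{div}(|\nabla u|^{p-2}\nabla u)$ in $\Omega_T$ if $$\iint_{\Omega_T}\left(-|u|^{p-2}u\,\phi_t+|\nabla u|^{p-2}\nabla u\cdot\nabla\phi\right)dx\,dt\le 0\qquad\text{for all }\phi\in C_0^\infty(\Omega_T),\ \phi\ge 0,$$ where $\nabla$ denotes the (weak) gradient in the space variable $x$. Let $u\ge 0$ be a weak subsolution in $\Omega_T$ and let $c>0$ be a constant. If $p<2$, assume in addition that $u$ is continuous in $\Omega_T$. Then $\max\{u,c\}$ is also a weak subsolution in $\Omega_T$. -/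

import Mathlib

open MeasureTheory Set
open scoped ContDiff

noncomputable section

namespace Trudinger

/-- The space-time cylinder `Ω_T = Ω × (0, T)`. -/
def cylinder {n : ℕ} (Ω : Set (EuclideanSpace ℝ (Fin n))) (T : ℝ) :
    Set (EuclideanSpace ℝ (Fin n) × ℝ) :=
  Ω ×ˢ Ioo 0 T

/-- `φ ∈ C_0^∞(U)`: a smooth real function with compact support contained in `U`. -/
structure IsTestFunction {X : Type*} [NormedAddCommGroup X] [NormedSpace ℝ X]
    (U : Set X) (φ : X → ℝ) : Prop where
  smooth : ContDiff ℝ ∞ φ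
  hasCompactSupport : HasCompactSupport φ
  tsupport_subset : tsupport φ ⊆ U

/-- `g` is the weak (distributional) gradient of `f` in the open set `Ω`: both are locally
integrable in `Ω` and `∫_Ω f ∇φ dx = - ∫_Ω φ g dx` for all `φ ∈ C_0^∞(Ω)`. -/
structure HasWeakGradientOn {n : ℕ} (Ω : Set (EuclideanSpace ℝ (Fin n)))
    (f : EuclideanSpace ℝ (Fin n) → ℝ)
    (g : EuclideanSpace ℝ (Fin n) → EuclideanSpace ℝ (Fin n)) : Prop where
  locallyIntegrableOn : LocallyIntegrableOn f Ω volume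
  locallyIntegrableOn_grad : LocallyIntegrableOn g Ω volume
  integral_eq : ∀ φ : EuclideanSpace ℝ (Fin n) → ℝ, IsTestFunction Ω φ →
    ∫ x in Ω, f x • gradient φ x = - ∫ x in Ω, φ x • g x

/-- `u ∈ L^p_loc(0, T; W^{1,p}_loc(Ω))` with spatial weak gradient `Du`: for almost every time
`t ∈ (0, T)` the function `Du(·, t)` is the weak gradient of `u(·, t)` in `Ω`, and
`∫_{t₁}^{t₂} ∫_K (|u|^p + |Du|^p) dx dt < ∞` for all compact `K ⊆ Ω` and `[t₁, t₂] ⊆ (0, T)`. -/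
structure MemParabolicSobolevLoc {n : ℕ} (p : ℝ) (Ω : Set (EuclideanSpace ℝ (Fin n))) (T : ℝ)
    (u : EuclideanSpace ℝ (Fin n) × ℝ → ℝ)
    (Du : EuclideanSpace ℝ (Fin n) × ℝ → EuclideanSpace ℝ (Fin n)) : Prop where
  hasWeakGradientOn : ∀ᵐ t ∂(volume.restrict (Ioo 0 T)),
    HasWeakGradientOn Ω (fun x => u (x, t)) (fun x => Du (x, t))
  memLp : ∀ K : Set (EuclideanSpace ℝ (Fin n)), IsCompact K → K ⊆ Ω →
    ∀ t₁ t₂ : ℝ, 0 < t₁ → t₂ < T →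
      MemLp u (ENNReal.ofReal p) (volume.restrict (K ×ˢ Icc t₁ t₂))
  memLp_grad : ∀ K : Set (EuclideanSpace ℝ (Fin n)), IsCompact K → K ⊆ Ω →
    ∀ t₁ t₂ : ℝ, 0 < t₁ → t₂ < T →
      MemLp Du (ENNReal.ofReal p) (volume.restrict (K ×ˢ Icc t₁ t₂))

/-- `u` is a weak subsolution of `∂_t(|u|^{p-2} u) = div(|∇u|^{p-2} ∇u)` in `Ω_T`:
`u ∈ L^p_loc(0, T; W^{1,p}_loc(Ω))` and
`∬_{Ω_T} (-|u|^{p-2} u φ_t + |∇u|^{p-2} ∇u · ∇φ) dx dt ≤ 0` for all `0 ≤ φ ∈ C_0^∞(Ω_T)`.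
The weak gradient is determined almost everywhere by `u`, so the choice of `Du` is immaterial. -/
def IsWeakSubsolution {n : ℕ} (p : ℝ) (Ω : Set (EuclideanSpace ℝ (Fin n))) (T : ℝ)
    (u : EuclideanSpace ℝ (Fin n) × ℝ → ℝ) : Prop :=
  ∃ Du : EuclideanSpace ℝ (Fin n) × ℝ → EuclideanSpace ℝ (Fin n),
    MemParabolicSobolevLoc p Ω T u Du ∧
    ∀ φ : EuclideanSpace ℝ (Fin n) × ℝ → ℝ, IsTestFunction (cylinder Ω T) φ →
      (∀ z, 0 ≤ φ z) →
      ∫ z in cylinder Ω T,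
        (-(|u z| ^ (p - 2) * u z * deriv (fun s => φ (z.1, s)) z.2)
          + inner ℝ (‖Du z‖ ^ (p - 2) • Du z) (gradient (fun y => φ (y, z.2)) z.1)) ≤ 0

end Trudinger

end

set_option linter.unusedSectionVars false

/-! Write b(s) = |s|^{p-2}s, v = b(u), k = b(c) and A = |∇u|^{p-2}∇u. Formally, test the inequality
for u with ψ = ηH(v), where H is a smooth nondecreasing approximation of the indicator of (k, ∞).
With G' = H, the time term becomes -G(v)η_t. The flux term becomes H(v) A·∇η plus η (H∘b)'(u)|∇u|^p,
which is nonnegative and can be dropped. As H tends to the indicator, G(v) tends to (v-k)_+ =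
b(max(u,c)) - k. The constant k integrates to zero against η_t, and what remains is the inequality
for max(u,c). Since c > 0, H∘b is C^1 with bounded derivative even where b is singular at the
origin.

The difficulty is that ψ has no time derivative. Only the test function is regularized: its
mollifications, shifted in time by τ, are admissible, and the subsolution inequality bounds the
τ-derivative of ∫ v φ(· - τ). Integrating over a short interval and using continuity of translations
in L^p gives a one-sided bound on a time difference of v tested with ψ (`exists_translate_sub_le`).
Convexity, G(b₂) - G(b₁) ≤ (b₂ - b₁)H(b₂), passes from differences of v to differences of G(v)
(`softPosPart_sub_le`). These can be moved onto the smooth η, so the step may shrink to zero with no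
time regularity of u (`integral_cutoff_le_zero`).

The gradients of ψ and of max(u,c) come from a chain rule for C^1 functions on almost every time
slice. -/

namespace Trudinger

open Filter Topology
open scoped Convolution

/-! ### Continuity of translations in L^p, and mollification. -/

section Translation

variable {G : Type*} [NormedAddCommGroup G] [NormedSpace ℝ G] [FiniteDimensional ℝ G]
  [MeasurableSpace G] [BorelSpace G] {μ : Measure G} [μ.IsAddHaarMeasure]
  {F F' : Type*} [NormedAddCommGroup F] [NormedSpace ℝ F] [NormedAddCommGroup F']
  [NormedSpace ℝ F']

/-- Translation is continuous in `L^p`. -/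
theorem continuous_toLp_comp_sub_right {p : ENNReal} [Fact (1 ≤ p)] (hp : p ≠ ⊤) {g : G → F}
    (hg : MemLp g p μ) :
    Continuous fun w : G =>
      (hg.comp_measurePreserving (measurePreserving_sub_right μ w)).toLp (fun z => g (z - w)) := by
  have hcont : Continuous
      (ContinuousMap.mk (fun a : G × G => a.2 - a.1) (by fun_prop)).curry :=
    (ContinuousMap.mk (fun a : G × G => a.2 - a.1) (by fun_prop)).curry.continuous
  exact (continuous_const (y := hg.toLp g)).compMeasurePreservingLp hcont
    (fun w => measurePreserving_sub_right μ w) hp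

/-- Pairing with a fixed L^p function is a continuous functional on L^q, composed here with the
continuous orbit of translates. This is the only continuity in time that the argument needs. -/
theorem continuous_integral_bilin_translate {p q : ℝ} (hpq : p.HolderConjugate q)
    (B : F →L[ℝ] F' →L[ℝ] ℝ) {f : G → F} {g : G → F'} (hf : MemLp f (ENNReal.ofReal p) μ)
    (hg : MemLp g (ENNReal.ofReal q) μ) :
    Continuous fun w : G => ∫ z, B (f z) (g (z - w)) ∂μ := by
  have : (ENNReal.ofReal p).HolderConjugate (ENNReal.ofReal q) := hpq.ennrealOfReal
  have : Fact (1 ≤ ENNReal.ofReal p) := ⟨by simpa using hpq.lt.le⟩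
  have : Fact (1 ≤ ENNReal.ofReal q) := ⟨by simpa using hpq.symm.lt.le⟩
  have h := (B.lpPairing μ (ENNReal.ofReal p) (ENNReal.ofReal q) (hf.toLp f)).continuous.comp
    (continuous_toLp_comp_sub_right ENNReal.ofReal_ne_top hg)
  refine h.congr fun w => ?_
  simp only [Function.comp_apply, ContinuousLinearMap.lpPairing_eq_integral]
  refine integral_congr_ae ?_
  filter_upwards [hf.coeFn_toLp,
    (hg.comp_measurePreserving (measurePreserving_sub_right μ w)).coeFn_toLp] with z h1 h2
  rw [h1]
  exact congrArg _ h2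

theorem continuous_integral_norm_translate_sub {f : G → F} (hf : Integrable f μ) :
    Continuous fun w : G => ∫ z, ‖f (z - w) - f z‖ ∂μ := by
  have hf1 : MemLp f 1 μ := memLp_one_iff_integrable.2 hf
  have h := ((continuous_toLp_comp_sub_right ENNReal.one_ne_top hf1).sub
    (continuous_const (y := hf1.toLp f))).norm
  refine h.congr fun w => ?_
  rw [L1.norm_eq_integral_norm]
  refine integral_congr_ae ?_
  filter_upwards [hf1.coeFn_toLp,
    (hf1.comp_measurePreserving (measurePreserving_sub_right μ w)).coeFn_toLp,
    Lp.coeFn_sub ((hf1.comp_measurePreserving (measurePreserving_sub_right μ w)).toLp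
      (fun z => f (z - w))) (hf1.toLp f)] with z h1 h2 h3
  refine (congrArg norm h3).trans ?_
  rw [Pi.sub_apply, h1]
  exact congrArg (fun y => ‖y - f z‖) h2

theorem integrable_convolution_integrand {ρ : G → ℝ} (hρ : Continuous ρ)
    (hρc : HasCompactSupport ρ) {g : G → F} (hg : LocallyIntegrable g μ) (z : G) :
    Integrable (fun w => ρ w • g (z - w)) μ :=
  (hρc.convolutionExists_left (ContinuousLinearMap.lsmul ℝ ℝ) hρ hg z)

/-- Mollification is an average of translations, tested against an `L^p` function. -/
theorem integral_bilin_convolution {p q : ℝ} (hpq : p.HolderConjugate q) [CompleteSpace F']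
    (B : F →L[ℝ] F' →L[ℝ] ℝ) {f : G → F} {g : G → F'} (hf : MemLp f (ENNReal.ofReal p) μ)
    (hg : MemLp g (ENNReal.ofReal q) μ) {ρ : G → ℝ} (hρ : Continuous ρ)
    (hρc : HasCompactSupport ρ) :
    ∫ z, B (f z) ((ρ ⋆[ContinuousLinearMap.lsmul ℝ ℝ, μ] g) z) ∂μ
      = ∫ w, ρ w * ∫ z, B (f z) (g (z - w)) ∂μ ∂μ := by
  have hgl : LocallyIntegrable g μ :=
    hg.locallyIntegrable (by simpa using hpq.symm.lt.le)
  have hρi : Integrable ρ μ := hρ.integrable_of_hasCompactSupport hρc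
  have hfp : Integrable (fun z => ‖f z‖ ^ p) μ := by
    simpa [ENNReal.toReal_ofReal hpq.nonneg] using
      hf.integrable_norm_rpow (by simpa using hpq.pos) ENNReal.ofReal_ne_top
  have hgq : Integrable (fun z => ‖g z‖ ^ q) μ := by
    simpa [ENNReal.toReal_ofReal hpq.symm.nonneg] using
      hg.integrable_norm_rpow (by simpa using hpq.symm.pos) ENNReal.ofReal_ne_top
  -- Fubini needs joint integrability. Young's inequality splits the integrand into a pure product
  -- and a convolution integrand of L^1 functions.
  have hint : Integrable (fun a : G × G => ρ a.2 * B (f a.1) (g (a.1 - a.2))) (μ.prod μ) := by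
    have hdom : Integrable (fun a : G × G => ‖B‖ * (‖f a.1‖ ^ p * ‖ρ a.2‖
        + ‖ρ a.2‖ * ‖g (a.1 - a.2)‖ ^ q)) (μ.prod μ) := by
      refine Integrable.const_mul (Integrable.add (hfp.mul_prod hρi.norm) ?_) _
      exact hρi.norm.convolution_integrand (ContinuousLinearMap.mul ℝ ℝ) hgq
    refine hdom.mono' ?_ (Eventually.of_forall fun a => ?_)
    · have h1 : AEStronglyMeasurable (fun a : G × G => ρ a.2 • g (a.1 - a.2)) (μ.prod μ) :=
        hρi.aestronglyMeasurable.convolution_integrand (ContinuousLinearMap.lsmul ℝ ℝ)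
          hg.aestronglyMeasurable
      have h2 : AEStronglyMeasurable (fun a : G × G => f a.1) (μ.prod μ) :=
        hf.aestronglyMeasurable.comp_fst
      refine (B.aestronglyMeasurable_comp₂ h2 h1).congr (Eventually.of_forall fun a => ?_)
      simp
    · rw [norm_mul]
      have hB : ‖B (f a.1) (g (a.1 - a.2))‖ ≤ ‖B‖ * (‖f a.1‖ * ‖g (a.1 - a.2)‖) := by
        rw [← mul_assoc]; exact B.le_opNorm₂ _ _
      have hy := Real.young_inequality_of_nonneg (norm_nonneg (f a.1))
        (norm_nonneg (g (a.1 - a.2))) hpq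
      have hy' : ‖f a.1‖ * ‖g (a.1 - a.2)‖ ≤ ‖f a.1‖ ^ p + ‖g (a.1 - a.2)‖ ^ q := by
        refine hy.trans (add_le_add ?_ ?_)
        · exact div_le_self (by positivity) hpq.lt.le
        · exact div_le_self (by positivity) hpq.symm.lt.le
      calc ‖ρ a.2‖ * ‖B (f a.1) (g (a.1 - a.2))‖
          ≤ ‖ρ a.2‖ * (‖B‖ * (‖f a.1‖ ^ p + ‖g (a.1 - a.2)‖ ^ q)) := by
            gcongr
            exact hB.trans (by gcongr)
        _ = _ := by ring
  calc ∫ z, B (f z) ((ρ ⋆[ContinuousLinearMap.lsmul ℝ ℝ, μ] g) z) ∂μ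
      = ∫ z, ∫ w, ρ w * B (f z) (g (z - w)) ∂μ ∂μ := by
        refine integral_congr_ae (Eventually.of_forall fun z => ?_)
        simp only [convolution_lsmul]
        rw [← (B (f z)).integral_comp_comm (integrable_convolution_integrand hρ hρc hgl z)]
        simp
    _ = ∫ w, ∫ z, ρ w * B (f z) (g (z - w)) ∂μ ∂μ := integral_integral_swap hint
    _ = _ := by simp only [integral_const_mul]

/-- `L^1` convergence of mollifications, quantified by the `L^1` modulus of continuity. -/
theorem integral_norm_convolution_sub_le [CompleteSpace F] {f : G → F} (hf : Integrable f μ)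
    {ρ : G → ℝ} (hρ : Continuous ρ) (hρc : HasCompactSupport ρ) (hρ0 : ∀ w, 0 ≤ ρ w)
    (hρ1 : ∫ w, ρ w ∂μ = 1) :
    ∫ z, ‖(ρ ⋆[ContinuousLinearMap.lsmul ℝ ℝ, μ] f) z - f z‖ ∂μ
      ≤ ∫ w, ρ w * ∫ z, ‖f (z - w) - f z‖ ∂μ ∂μ := by
  have hρi : Integrable ρ μ := hρ.integrable_of_hasCompactSupport hρc
  have h1 : Integrable (fun a : G × G => ρ a.2 • f (a.1 - a.2)) (μ.prod μ) :=
    hρi.convolution_integrand (ContinuousLinearMap.lsmul ℝ ℝ) hf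
  have h2 : Integrable (fun a : G × G => ρ a.2 • f a.1) (μ.prod μ) := by
    exact (hρi.smul_prod hf).swap
  have hint : Integrable (fun a : G × G => ρ a.2 • (f (a.1 - a.2) - f a.1)) (μ.prod μ) := by
    simp only [smul_sub]
    exact h1.sub h2
  have hpt : ∀ z, ‖(ρ ⋆[ContinuousLinearMap.lsmul ℝ ℝ, μ] f) z - f z‖
      ≤ ∫ w, ‖ρ w • (f (z - w) - f z)‖ ∂μ := by
    intro z
    have : (ρ ⋆[ContinuousLinearMap.lsmul ℝ ℝ, μ] f) z - f z
        = ∫ w, ρ w • (f (z - w) - f z) ∂μ := by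
      simp only [smul_sub, convolution_lsmul]
      rw [integral_sub (integrable_convolution_integrand hρ hρc hf.locallyIntegrable z)
        (hρi.smul_const _), integral_smul_const, hρ1, one_smul]
    rw [this]
    exact norm_integral_le_integral_norm _
  calc ∫ z, ‖(ρ ⋆[ContinuousLinearMap.lsmul ℝ ℝ, μ] f) z - f z‖ ∂μ
      ≤ ∫ z, ∫ w, ‖ρ w • (f (z - w) - f z)‖ ∂μ ∂μ :=
        integral_mono_of_nonneg (Eventually.of_forall fun z => norm_nonneg _)
          hint.norm.integral_prod_left (Eventually.of_forall hpt)
    _ = ∫ w, ∫ z, ‖ρ w • (f (z - w) - f z)‖ ∂μ ∂μ := integral_integral_swap hint.norm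
    _ = _ := by
        simp only [norm_smul, integral_const_mul, Real.norm_of_nonneg (hρ0 _)]

/-- A sequence of bump functions concentrating at the origin. -/
noncomputable def bump (G : Type*) [NormedAddCommGroup G] (j : ℕ) : ContDiffBump (0 : G) where
  rIn := 1 / ((j : ℝ) + 1)
  rOut := 2 * (1 / ((j : ℝ) + 1))
  rIn_pos := by positivity
  rIn_lt_rOut := by
    have : (0 : ℝ) < 1 / ((j : ℝ) + 1) := by positivity
    linarith

theorem tendsto_bump_rOut : Tendsto (fun j => (bump G j).rOut) atTop (𝓝 0) := by
  simpa [bump] using (tendsto_one_div_add_atTop_nhds_zero_nat (𝕜 := ℝ)).const_mul 2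

/-- The integral is the value at the origin of the convolution of the bump with the reflected
function `N ∘ Neg.neg`. -/
theorem tendsto_integral_bump_mul {N : G → ℝ} (hN : Continuous N) :
    Tendsto (fun j => ∫ w, (bump G j).normed μ w * N w ∂μ) atTop (𝓝 (N 0)) := by
  have h := ContDiffBump.convolution_tendsto_right_of_continuous (μ := μ)
    (tendsto_bump_rOut (G := G)) (hN.comp continuous_neg) 0
  simpa [convolution_lsmul] using h

theorem tendsto_integral_norm_bump_convolution_sub [CompleteSpace F] {f : G → F}
    (hf : Integrable f μ) :
    Tendsto (fun j => ∫ z, ‖((bump G j).normed μ ⋆[ContinuousLinearMap.lsmul ℝ ℝ, μ] f) z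
      - f z‖ ∂μ) atTop (𝓝 0) := by
  have h := tendsto_integral_bump_mul (μ := μ) (continuous_integral_norm_translate_sub hf)
  simp only [sub_zero, sub_self, norm_zero, integral_zero] at h
  refine squeeze_zero (fun j => integral_nonneg fun z => norm_nonneg _) (fun j => ?_) h
  exact integral_norm_convolution_sub_le hf (bump G j).continuous_normed
    (bump G j).hasCompactSupport_normed (bump G j).nonneg_normed (bump G j).integral_normed

theorem fderiv_convolution_apply {ρ f : G → ℝ} (hρ : ContDiff ℝ ∞ ρ) (hρc : HasCompactSupport ρ)
    (hf : LocallyIntegrable f μ) (x v : G) :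
    fderiv ℝ (ρ ⋆[ContinuousLinearMap.lsmul ℝ ℝ, μ] f) x v
      = ∫ y, f y * fderiv ℝ ρ (x - y) v ∂μ := by
  have h1 : ContDiff ℝ 1 ρ := hρ.of_le (by simp)
  have h := hρc.hasFDerivAt_convolution_left (ContinuousLinearMap.lsmul ℝ ℝ) h1 hf x
  rw [h.fderiv, convolution_eq_swap, ContinuousLinearMap.integral_apply]
  · simp [ContinuousLinearMap.precompL_apply, mul_comm]
  · have := (hρc.fderiv (𝕜 := ℝ)).convolutionExists_left
      ((ContinuousLinearMap.lsmul ℝ ℝ).precompL G : (G →L[ℝ] ℝ) →L[ℝ] ℝ →L[ℝ] G →L[ℝ] ℝ)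
      (hρ.continuous_fderiv (by simp)) hf x
    exact this.integrable_swap

/-- Differentiation of a translated test function under the integral sign. -/
theorem hasDerivAt_integral_mul_translate {f φ : G → ℝ} (hf : Integrable f μ)
    (hφ : ContDiff ℝ ∞ φ) (hφc : HasCompactSupport φ) (v : G) (τ : ℝ) :
    HasDerivAt (fun τ : ℝ => ∫ z, f z * φ (z - τ • v) ∂μ)
      (-∫ z, f z * fderiv ℝ φ (z - τ • v) v ∂μ) τ := by
  have hdc : Continuous fun z => fderiv ℝ φ z v :=
    (hφ.continuous_fderiv (by simp)).clm_apply continuous_const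
  have hds : HasCompactSupport fun z => fderiv ℝ φ z v := hφc.fderiv_apply (𝕜 := ℝ) v
  obtain ⟨C, hC⟩ := hds.exists_bound_of_continuous hdc
  obtain ⟨C', hC'⟩ := hφc.exists_bound_of_continuous hφ.continuous
  have h := hasDerivAt_integral_of_dominated_loc_of_deriv_le (μ := μ) (x₀ := τ) (s := univ)
    (F := fun τ z => f z * φ (z - τ • v)) (F' := fun τ z => -(f z * fderiv ℝ φ (z - τ • v) v))
    (bound := fun z => ‖f z‖ * C) univ_mem ?_ ?_ ?_ ?_ (hf.norm.mul_const _) ?_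
  · rw [← integral_neg]; exact h.2
  · exact Eventually.of_forall fun t => hf.aestronglyMeasurable.mul
      (hφ.continuous.comp (by fun_prop)).aestronglyMeasurable
  · exact hf.mul_bdd (c := C') (hφ.continuous.comp (by fun_prop)).aestronglyMeasurable
      (Eventually.of_forall fun z => hC' _)
  · exact (hf.aestronglyMeasurable.mul (hdc.comp (by fun_prop)).aestronglyMeasurable).neg
  · refine Eventually.of_forall fun z t _ => ?_
    rw [norm_neg, norm_mul]
    gcongr
    exact hC _
  · refine Eventually.of_forall fun z t _ => ?_
    have h1 : HasDerivAt (fun t : ℝ => z - t • v) (-v) t := by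
      simpa using ((hasDerivAt_id t).smul_const v).const_sub z
    have h2 := ((hφ.differentiable (by simp)) (z - t • v)).hasFDerivAt.comp_hasDerivAt t h1
    simpa using h2.const_mul (f z)

end Translation

/-! ### Integrability against compactly supported factors. -/

section Integrability

variable {X : Type*} [NormedAddCommGroup X] [NormedSpace ℝ X] [MeasurableSpace X] [BorelSpace X]
  [SecondCountableTopology X] {μ : Measure X} {F : Type*} [NormedAddCommGroup F] [NormedSpace ℝ F]

theorem LocallyIntegrableOn.integrable_smul_of_hasCompactSupport {U : Set X} {h : X → F}
    (hh : LocallyIntegrableOn h U μ) {k : X → ℝ} (hk : Continuous k) (hkc : HasCompactSupport k)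
    (hkU : tsupport k ⊆ U) : Integrable (fun x => k x • h x) μ := by
  have h1 : IntegrableOn h (tsupport k) μ := hh.integrableOn_compact_subset hkU hkc
  obtain ⟨C, hC⟩ := hkc.exists_bound_of_continuous hk
  have h2 : IntegrableOn (fun x => k x • h x) (tsupport k) μ :=
    Integrable.bdd_smul h1 C hk.aestronglyMeasurable (Eventually.of_forall hC)
  refine (integrableOn_iff_integrable_of_support_subset ?_).1 h2
  exact (Function.support_smul_subset_left k h).trans (subset_tsupport k)

theorem LocallyIntegrableOn.integrable_smul_vector_of_hasCompactSupport {U : Set X} {h : X → ℝ}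
    (hh : LocallyIntegrableOn h U μ) {k : X → F} (hk : Continuous k) (hkc : HasCompactSupport k)
    (hkU : tsupport k ⊆ U) : Integrable (fun x => h x • k x) μ := by
  have h1 : IntegrableOn h (tsupport k) μ := hh.integrableOn_compact_subset hkU hkc
  obtain ⟨C, hC⟩ := hkc.exists_bound_of_continuous hk
  have h2 : IntegrableOn (fun x => h x • k x) (tsupport k) μ :=
    Integrable.smul_bdd h1 C hk.aestronglyMeasurable.restrict (Eventually.of_forall hC)
  refine (integrableOn_iff_integrable_of_support_subset ?_).1 h2
  exact (Function.support_smul_subset_right h k).trans (subset_tsupport k)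

theorem tendsto_integral_of_norm_sub_le {Y : ℕ → X → ℝ} {Z : X → ℝ} {d : ℕ → X → ℝ} {M : ℝ}
    (hY : ∀ j, Integrable (Y j) μ) (hZ : Integrable Z μ) (hd : ∀ j, Integrable (d j) μ)
    (hle : ∀ j x, ‖Y j x - Z x‖ ≤ M * d j x)
    (hlim : Tendsto (fun j => ∫ x, d j x ∂μ) atTop (𝓝 0)) :
    Tendsto (fun j => ∫ x, Y j x ∂μ) atTop (𝓝 (∫ x, Z x ∂μ)) := by
  rw [tendsto_iff_norm_sub_tendsto_zero]
  have h0 := hlim.const_mul M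
  rw [mul_zero] at h0
  refine squeeze_zero (fun _ => norm_nonneg _) (fun j => ?_) h0
  rw [← integral_sub (hY j) hZ, ← integral_const_mul]
  exact norm_integral_le_of_norm_le ((hd j).const_mul M) (Eventually.of_forall (hle j))

end Integrability

namespace IsTestFunction

variable {X : Type*} [NormedAddCommGroup X] [NormedSpace ℝ X] {U : Set X} {φ : X → ℝ}

theorem continuous_fderiv_apply (h : IsTestFunction U φ) (v : X) :
    Continuous fun x => fderiv ℝ φ x v :=
  (h.smooth.continuous_fderiv (by simp)).clm_apply continuous_const

theorem hasCompactSupport_fderiv_apply (h : IsTestFunction U φ) (v : X) :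
    HasCompactSupport fun x => fderiv ℝ φ x v :=
  h.hasCompactSupport.fderiv_apply (𝕜 := ℝ) v

theorem tsupport_fderiv_apply_subset (h : IsTestFunction U φ) (v : X) :
    tsupport (fun x => fderiv ℝ φ x v) ⊆ U :=
  (_root_.tsupport_fderiv_apply_subset ℝ v).trans h.tsupport_subset

end IsTestFunction

/-! ### Weak gradients in space: mollification and the chain rule. -/

section Slice

variable {n : ℕ} {Ω : Set (EuclideanSpace ℝ (Fin n))}
  {f : EuclideanSpace ℝ (Fin n) → ℝ} {g : EuclideanSpace ℝ (Fin n) → EuclideanSpace ℝ (Fin n)}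

local notation "𝔼" => EuclideanSpace ℝ (Fin n)

theorem setIntegral_smul_gradient_eq {φ : 𝔼 → ℝ} (hφ : IsTestFunction Ω φ) :
    ∫ x in Ω, f x • gradient φ x = ∫ x, f x • gradient φ x := by
  refine setIntegral_eq_integral_of_forall_compl_eq_zero fun x hx => ?_
  have : fderiv ℝ φ x = 0 := by
    by_contra h
    exact hx (hφ.tsupport_subset (support_fderiv_subset ℝ h))
  simp [gradient, this]

theorem setIntegral_testFunction_smul_eq {φ : 𝔼 → ℝ} (hφ : IsTestFunction Ω φ) :
    ∫ x in Ω, φ x • g x = ∫ x, φ x • g x := by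
  refine setIntegral_eq_integral_of_forall_compl_eq_zero fun x hx => ?_
  rw [image_eq_zero_of_notMem_tsupport (fun h => hx (hφ.tsupport_subset h)), zero_smul]

theorem integrable_smul_gradient (hf : LocallyIntegrableOn f Ω volume) {φ : 𝔼 → ℝ}
    (hφ : IsTestFunction Ω φ) : Integrable (fun x => f x • gradient φ x) := by
  have hsub : tsupport (gradient φ) ⊆ tsupport φ := by
    refine closure_minimal (fun x hx => ?_) (isClosed_tsupport φ)
    refine support_fderiv_subset ℝ (f := φ) fun h => hx ?_
    simp [gradient, h]
  refine LocallyIntegrableOn.integrable_smul_vector_of_hasCompactSupport hf ?_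
    (hφ.hasCompactSupport.of_isClosed_subset (isClosed_tsupport _) hsub)
    (hsub.trans hφ.tsupport_subset)
  exact (InnerProductSpace.toDual ℝ 𝔼).symm.continuous.comp
    (hφ.smooth.continuous_fderiv (by simp))

theorem HasWeakGradientOn.integral_fderiv (h : HasWeakGradientOn Ω f g) {φ : 𝔼 → ℝ}
    (hφ : IsTestFunction Ω φ) (e : 𝔼) :
    ∫ x, f x * fderiv ℝ φ x e = -∫ x, φ x * inner ℝ e (g x) := by
  have h1 := h.integral_eq φ hφ
  rw [setIntegral_smul_gradient_eq hφ, setIntegral_testFunction_smul_eq hφ] at h1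
  have h2 := congrArg (fun y => inner ℝ e y) h1
  simp only [inner_neg_right] at h2
  rw [← integral_inner (integrable_smul_gradient h.locallyIntegrableOn hφ),
    ← integral_inner (LocallyIntegrableOn.integrable_smul_of_hasCompactSupport
      h.locallyIntegrableOn_grad hφ.smooth.continuous hφ.hasCompactSupport
      hφ.tsupport_subset)] at h2
  simpa [inner_smul_right, inner_gradient_right] using h2

theorem HasWeakGradientOn.of_integral_fderiv (hf : LocallyIntegrableOn f Ω volume)
    (hg : LocallyIntegrableOn g Ω volume)
    (h : ∀ φ : 𝔼 → ℝ, IsTestFunction Ω φ → ∀ e : 𝔼,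
      ∫ x, f x * fderiv ℝ φ x e = -∫ x, φ x * inner ℝ e (g x)) :
    HasWeakGradientOn Ω f g where
  locallyIntegrableOn := hf
  locallyIntegrableOn_grad := hg
  integral_eq φ hφ := by
    rw [setIntegral_smul_gradient_eq hφ, setIntegral_testFunction_smul_eq hφ]
    refine ext_inner_left ℝ fun e => ?_
    rw [inner_neg_right, ← integral_inner (integrable_smul_gradient hf hφ),
      ← integral_inner (LocallyIntegrableOn.integrable_smul_of_hasCompactSupport
        hg hφ.smooth.continuous hφ.hasCompactSupport hφ.tsupport_subset)]
    simpa [inner_smul_right, inner_gradient_right] using h φ hφ e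

theorem fderiv_comp_const_sub {X : Type*} [NormedAddCommGroup X] [NormedSpace ℝ X] {ρ : X → ℝ}
    (hρ : Differentiable ℝ ρ) (x y v : X) :
    fderiv ℝ (fun y => ρ (x - y)) y v = -fderiv ℝ ρ (x - y) v := by
  have h := (hρ (x - y)).hasFDerivAt.comp y ((hasFDerivAt_id y).const_sub x)
  have h2 : fderiv ℝ (fun y => ρ (x - y)) y = _ := h.fderiv
  rw [h2]; simp

theorem isTestFunction_comp_const_sub {X : Type*} [NormedAddCommGroup X] [NormedSpace ℝ X]
    {U : Set X} {ρ : X → ℝ} (hρ : ContDiff ℝ ∞ ρ) (hρc : HasCompactSupport ρ) {r : ℝ}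
    (hρr : tsupport ρ ⊆ Metric.closedBall 0 r) (x : X) (hU : Metric.closedBall x r ⊆ U) :
    IsTestFunction U (fun y => ρ (x - y)) ∧
      tsupport (fun y => ρ (x - y)) ⊆ Metric.closedBall x r := by
  have hs : tsupport (fun y => ρ (x - y)) ⊆ Metric.closedBall x r := by
    refine closure_minimal (fun y hy => ?_) Metric.isClosed_closedBall
    have := hρr (subset_tsupport ρ hy)
    rw [mem_closedBall_zero_iff] at this
    rwa [Metric.mem_closedBall, dist_comm, dist_eq_norm]
  exact ⟨⟨hρ.comp (by fun_prop), hρc.comp_homeomorph (Homeomorph.subLeft x), hs.trans hU⟩, hs⟩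

/-- The function y ↦ ρ(x - y) is itself a test function supported in `K`, so the definition of the
weak gradient applies to it directly. Cutting `f` and `g` off outside `K` is invisible at such x. -/
theorem HasWeakGradientOn.fderiv_convolution (h : HasWeakGradientOn Ω f g) {K : Set 𝔼}
    (hK : IsCompact K) (hKΩ : K ⊆ Ω) {ρ : 𝔼 → ℝ} (hρ : ContDiff ℝ ∞ ρ)
    (hρc : HasCompactSupport ρ) {r : ℝ} (hρr : tsupport ρ ⊆ Metric.closedBall 0 r) {x : 𝔼}
    (hx : Metric.closedBall x r ⊆ K) (e : 𝔼) :
    fderiv ℝ (ρ ⋆[ContinuousLinearMap.lsmul ℝ ℝ, volume] K.indicator f) x e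
      = inner ℝ e ((ρ ⋆[ContinuousLinearMap.lsmul ℝ ℝ, volume] K.indicator g) x) := by
  have hfK : Integrable (K.indicator f) :=
    (h.locallyIntegrableOn.integrableOn_compact_subset hKΩ hK).integrable_indicator
      hK.measurableSet
  have hgK : Integrable (K.indicator g) :=
    (h.locallyIntegrableOn_grad.integrableOn_compact_subset hKΩ hK).integrable_indicator
      hK.measurableSet
  obtain ⟨hθ, hθs⟩ := isTestFunction_comp_const_sub hρ hρc hρr x (hx.trans hKΩ)
  rw [fderiv_convolution_apply hρ hρc hfK.locallyIntegrable, convolution_lsmul_swap,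
    ← integral_inner]
  · have h1 := h.integral_fderiv hθ e
    rw [eq_comm, neg_eq_iff_eq_neg, ← integral_neg] at h1
    convert h1.symm using 1
    · refine integral_congr_ae (Eventually.of_forall fun y => ?_)
      by_cases hy : y ∈ K
      · simp only [indicator_of_mem hy, fderiv_comp_const_sub (hρ.differentiable (by simp))]
        ring
      · have hz : fderiv ℝ (fun y => ρ (x - y)) y = 0 := by
          by_contra h0
          exact hy (hx (hθs (support_fderiv_subset ℝ h0)))
        simp [indicator_of_notMem hy, hz]
    · refine integral_congr_ae (Eventually.of_forall fun y => ?_)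
      by_cases hy : y ∈ K
      · simp only [indicator_of_mem hy, inner_smul_right]
      · have hz : ρ (x - y) = 0 :=
          image_eq_zero_of_notMem_tsupport (f := fun y => ρ (x - y)) fun h0 => hy (hx (hθs h0))
        simp [indicator_of_notMem hy, hz]
  · exact (hρc.convolutionExists_left (ContinuousLinearMap.lsmul ℝ ℝ) hρ.continuous
      hgK.locallyIntegrable x).integrable_swap

/-- Chain rule for weak gradients. -/
theorem HasWeakGradientOn.comp_contDiff (hΩ : IsOpen Ω) (h : HasWeakGradientOn Ω f g) {F : ℝ → ℝ}
    (hF : ContDiff ℝ 1 F) {C : ℝ} (hC : ∀ s, |deriv F s| ≤ C) :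
    HasWeakGradientOn Ω (fun x => F (f x)) (fun x => deriv F (f x) • g x) := by
  have hF' : Continuous (deriv F) := hF.continuous_deriv le_rfl
  have hC0 : 0 ≤ C := (abs_nonneg _).trans (hC 0)
  have hlip : ∀ s t, ‖F s - F t‖ ≤ C * ‖s - t‖ := fun s t =>
    Convex.norm_image_sub_le_of_norm_deriv_le (s := univ)
      (fun x _ => (hF.differentiable one_ne_zero) x) (fun x _ => hC x) convex_univ trivial trivial
  refine HasWeakGradientOn.of_integral_fderiv ?_ ?_ ?_
  · rw [locallyIntegrableOn_iff hΩ.isLocallyClosed]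
    intro K hKΩ hK
    have hfK := h.locallyIntegrableOn.integrableOn_compact_subset hKΩ hK
    have : IsFiniteMeasure (volume.restrict K) := ⟨by simpa using hK.measure_lt_top⟩
    refine Integrable.mono' (g := fun x => C * ‖f x‖ + ‖F 0‖)
      ((hfK.norm.const_mul C).add (integrable_const _))
      (hF.continuous.comp_aestronglyMeasurable hfK.aestronglyMeasurable)
      (Eventually.of_forall fun x => ?_)
    have := hlip (f x) 0
    rw [sub_zero] at this
    calc ‖F (f x)‖ = ‖(F (f x) - F 0) + F 0‖ := by simp
      _ ≤ _ := (norm_add_le _ _).trans (by gcongr)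
  · rw [locallyIntegrableOn_iff hΩ.isLocallyClosed]
    intro K hKΩ hK
    have hfK := h.locallyIntegrableOn.integrableOn_compact_subset hKΩ hK
    have hgK := h.locallyIntegrableOn_grad.integrableOn_compact_subset hKΩ hK
    exact Integrable.bdd_smul (φ := fun x => deriv F (f x)) hgK C
      (hF'.comp_aestronglyMeasurable hfK.aestronglyMeasurable)
      (Eventually.of_forall fun x => hC _)
  intro φ hφ e
  -- Localize: on `K` the functions become globally integrable, and small balls centred on the
  -- support of φ stay inside `K`, where mollification commutes with the gradient.
  obtain ⟨K, hK, hφK, hKΩ⟩ := exists_compact_between hφ.hasCompactSupport hΩ hφ.tsupport_subset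
  obtain ⟨r, hr, hrK⟩ :=
    hφ.hasCompactSupport.isCompact.exists_cthickening_subset_open isOpen_interior hφK
  have hball : ∀ x ∈ tsupport φ, ∀ s ≤ r, Metric.closedBall x s ⊆ K := fun x hx s hs =>
    ((Metric.closedBall_subset_closedBall hs).trans
      (Metric.closedBall_subset_cthickening hx r)).trans (hrK.trans interior_subset)
  set f₁ := K.indicator f with hf₁
  set g₁ := K.indicator g with hg₁
  have hfK : Integrable f₁ :=
    (h.locallyIntegrableOn.integrableOn_compact_subset hKΩ hK).integrable_indicator
      hK.measurableSet
  have hgK : Integrable g₁ :=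
    (h.locallyIntegrableOn_grad.integrableOn_compact_subset hKΩ hK).integrable_indicator
      hK.measurableSet
  let ρ : ℕ → 𝔼 → ℝ := fun j => (bump 𝔼 j).normed volume
  have hρ : ∀ j, ContDiff ℝ ∞ (ρ j) := fun j => (bump 𝔼 j).contDiff_normed
  have hρc : ∀ j, HasCompactSupport (ρ j) := fun j => (bump 𝔼 j).hasCompactSupport_normed
  let fj : ℕ → 𝔼 → ℝ := fun j => ρ j ⋆[ContinuousLinearMap.lsmul ℝ ℝ, volume] f₁
  let gj : ℕ → 𝔼 → 𝔼 := fun j => ρ j ⋆[ContinuousLinearMap.lsmul ℝ ℝ, volume] g₁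
  have hfjs : ∀ j, ContDiff ℝ ∞ (fj j) := fun j =>
    (hρc j).contDiff_convolution_left _ (hρ j) hfK.locallyIntegrable
  have hgjs : ∀ j, Continuous (gj j) := fun j =>
    (hρc j).continuous_convolution_left _ (hρ j).continuous hgK.locallyIntegrable
  have hfji : ∀ j, Integrable (fj j) := fun j => Integrable.integrable_convolution _
    ((hρ j).continuous.integrable_of_hasCompactSupport (hρc j)) hfK
  have hgji : ∀ j, Integrable (gj j) := fun j => Integrable.integrable_convolution _
    ((hρ j).continuous.integrable_of_hasCompactSupport (hρc j)) hgK
  have hae : ∀ᵐ x, Tendsto (fun j => fj j x) atTop (𝓝 (f₁ x)) :=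
    ContDiffBump.ae_convolution_tendsto_right_of_locallyIntegrable (K := 2) tendsto_bump_rOut
      (Eventually.of_forall fun j => le_rfl) hfK.locallyIntegrable
  have hφe := hφ.continuous_fderiv_apply e
  have hφec := hφ.hasCompactSupport_fderiv_apply e
  obtain ⟨C₁, hC₁⟩ := hφec.exists_bound_of_continuous hφe
  obtain ⟨C₂, hC₂⟩ := hφ.hasCompactSupport.exists_bound_of_continuous hφ.smooth.continuous
  have hC₁0 : 0 ≤ C₁ := (norm_nonneg _).trans (hC₁ 0)
  have hC₂0 : 0 ≤ C₂ := (norm_nonneg _).trans (hC₂ 0)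
  have hmeasF' : AEStronglyMeasurable (fun x => deriv F (f₁ x)) :=
    hF'.comp_aestronglyMeasurable hfK.aestronglyMeasurable
  have hlocF : LocallyIntegrable (fun x => F (f₁ x)) := by
    rw [locallyIntegrable_iff]
    intro L hL
    have : IsFiniteMeasure (volume.restrict L) := ⟨by simpa using hL.measure_lt_top⟩
    refine Integrable.mono' (g := fun x => C * ‖f₁ x‖ + ‖F 0‖)
      ((hfK.restrict.norm.const_mul C).add (integrable_const _))
      (hF.continuous.comp_aestronglyMeasurable hfK.aestronglyMeasurable.restrict)
      (Eventually.of_forall fun x => ?_)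
    have := hlip (f₁ x) 0
    rw [sub_zero] at this
    calc ‖F (f₁ x)‖ = ‖(F (f₁ x) - F 0) + F 0‖ := by simp
      _ ≤ _ := (norm_add_le _ _).trans (by gcongr)
  -- `F` is Lipschitz, so L^1 convergence of the mollifications passes to `F (fj j)`.
  have hlim1 : Tendsto (fun j => ∫ x, F (fj j x) * fderiv ℝ φ x e) atTop
      (𝓝 (∫ x, F (f₁ x) * fderiv ℝ φ x e)) := by
    refine tendsto_integral_of_norm_sub_le (d := fun j x => ‖fj j x - f₁ x‖) (M := C * C₁)
      (fun j => ?_) ?_ (fun j => ((hfji j).sub hfK).norm) (fun j x => ?_)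
      (tendsto_integral_norm_bump_convolution_sub hfK)
    · exact ((hF.continuous.comp (hfjs j).continuous).mul hφe).integrable_of_hasCompactSupport
        hφec.mul_left
    · simpa [mul_comm] using hlocF.integrable_smul_left_of_hasCompactSupport hφe hφec
    · rw [← sub_mul, norm_mul]
      calc _ ≤ (C * ‖fj j x - f₁ x‖) * C₁ := by
            gcongr
            · exact hlip _ _
            · exact hC₁ x
        _ = _ := by ring
  have hXi : ∀ j, Integrable (fun x => φ x * (deriv F (fj j x) * inner ℝ e (gj j x))) := fun j => by
    refine Continuous.integrable_of_hasCompactSupport ?_ hφ.hasCompactSupport.mul_right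
    exact hφ.smooth.continuous.mul ((hF'.comp (hfjs j).continuous).mul
      (continuous_const.inner (hgjs j)))
  have hgei : Integrable (fun x => inner ℝ e (g₁ x)) := hgK.const_inner e
  have hbd : ∀ (s : ℝ) x, ‖φ x * (deriv F s * inner ℝ e (g₁ x))‖
      ≤ C₂ * (C * ‖inner ℝ e (g₁ x)‖) := fun s x => by
    rw [norm_mul, norm_mul]
    gcongr
    · exact hC₂ x
    · exact hC s
  have hYi : ∀ j, Integrable (fun x => φ x * (deriv F (fj j x) * inner ℝ e (g₁ x))) := fun j => by
    refine Integrable.mono' ((hgei.norm.const_mul C).const_mul C₂) ?_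
      (Eventually.of_forall fun x => hbd _ x)
    exact hφ.smooth.continuous.aestronglyMeasurable.mul
      ((hF'.comp (hfjs j).continuous).aestronglyMeasurable.mul hgei.aestronglyMeasurable)
  -- The product of `deriv F (fj j)` and `gj j` is split in two: with the gradient frozen at `g₁`,
  -- a.e. convergence and domination suffice; the remainder is controlled by the L^1 distance from
  -- `gj j` to `g₁`.
  have hlim2 : Tendsto (fun j => ∫ x, φ x * (deriv F (fj j x) * inner ℝ e (g₁ x))) atTop
      (𝓝 (∫ x, φ x * (deriv F (f₁ x) * inner ℝ e (g₁ x)))) := by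
    refine tendsto_integral_of_dominated_convergence
      (fun x => C₂ * (C * ‖inner ℝ e (g₁ x)‖)) (fun j => (hYi j).aestronglyMeasurable)
      ((hgei.norm.const_mul C).const_mul C₂) (fun j => Eventually.of_forall fun x => hbd _ x) ?_
    filter_upwards [hae] with x hx
    exact (((hF'.tendsto _).comp hx).mul_const _).const_mul _
  have hlim3 : Tendsto (fun j => ∫ x, (φ x * (deriv F (fj j x) * inner ℝ e (gj j x))
      - φ x * (deriv F (fj j x) * inner ℝ e (g₁ x)))) atTop (𝓝 (∫ _ : 𝔼, (0 : ℝ))) := by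
    refine tendsto_integral_of_norm_sub_le (d := fun j x => ‖gj j x - g₁ x‖)
      (M := C₂ * (C * ‖e‖)) (fun j => (hXi j).sub (hYi j)) (integrable_zero _ _ _)
      (fun j => ((hgji j).sub hgK).norm) (fun j x => ?_)
      (tendsto_integral_norm_bump_convolution_sub hgK)
    rw [sub_zero, ← mul_sub, ← mul_sub, ← inner_sub_right, norm_mul, norm_mul, mul_assoc, mul_assoc]
    gcongr
    · exact hC₂ x
    · exact hC _
    · exact norm_inner_le_norm _ _
  have hlim4 : Tendsto (fun j => ∫ x, φ x * (deriv F (fj j x) * inner ℝ e (gj j x))) atTop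
      (𝓝 (∫ x, φ x * (deriv F (f₁ x) * inner ℝ e (g₁ x)))) := by
    have := hlim3.add hlim2
    simp only [integral_zero, zero_add] at this
    refine this.congr fun j => ?_
    rw [integral_sub (hXi j) (hYi j), sub_add_cancel]
  -- For smooth approximants this is classical integration by parts, valid once the mollification
  -- radius is at most `r`.
  have hev : ∀ᶠ j in atTop, ∫ x, F (fj j x) * fderiv ℝ φ x e
      = -∫ x, φ x * (deriv F (fj j x) * inner ℝ e (gj j x)) := by
    filter_upwards [(tendsto_bump_rOut (G := 𝔼)).eventually (ge_mem_nhds hr)] with j hj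
    have hder : ∀ x, fderiv ℝ (fun x => F (fj j x)) x e
        = deriv F (fj j x) * fderiv ℝ (fj j) x e := fun x => by
      have h1 := ((hF.differentiable one_ne_zero) (fj j x)).hasDerivAt.comp_hasFDerivAt x
        (((hfjs j).differentiable (by simp)) x).hasFDerivAt
      have h2 : fderiv ℝ (fun x => F (fj j x)) x = _ := h1.fderiv
      rw [h2]; simp
    have hFfj : ContDiff ℝ 1 (fun x => F (fj j x)) := hF.comp ((hfjs j).of_le (by simp))
    have hibp := integral_mul_fderiv_eq_neg_fderiv_mul_of_integrable (μ := (volume : Measure 𝔼))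
      (f := fun x => F (fj j x)) (g := φ) (v := e)
      ((((hFfj.continuous_fderiv one_ne_zero).clm_apply continuous_const).mul
        hφ.smooth.continuous).integrable_of_hasCompactSupport hφ.hasCompactSupport.mul_left)
      ((hFfj.continuous.mul hφe).integrable_of_hasCompactSupport hφec.mul_left)
      ((hFfj.continuous.mul hφ.smooth.continuous).integrable_of_hasCompactSupport
        hφ.hasCompactSupport.mul_left)
      (fun x _ => (hFfj.differentiable one_ne_zero) x)
      (fun x _ => (hφ.smooth.differentiable (by simp)) x)
    rw [hibp]
    congr 1
    refine integral_congr_ae (Eventually.of_forall fun x => ?_)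
    by_cases hx : x ∈ tsupport φ
    · have := h.fderiv_convolution hK hKΩ (hρ j) (hρc j) (r := (bump 𝔼 j).rOut)
        (bump 𝔼 j).tsupport_normed_eq.subset (hball x hx _ hj) e
      simp only [hder]
      rw [show fderiv ℝ (fj j) x e = inner ℝ e (gj j x) from this]
      ring
    · simp [image_eq_zero_of_notMem_tsupport hx]
  have hfin := tendsto_nhds_unique (hlim1.congr' hev) hlim4.neg
  convert hfin using 1
  · refine integral_congr_ae (Eventually.of_forall fun x => ?_)
    by_cases hx : x ∈ tsupport φ
    · simp [hf₁, indicator_of_mem (interior_subset (hφK hx))]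
    · have : fderiv ℝ φ x = 0 := by
        by_contra h0
        exact hx (support_fderiv_subset ℝ h0)
      simp [this]
  · congr 1
    refine integral_congr_ae (Eventually.of_forall fun x => ?_)
    by_cases hx : x ∈ tsupport φ
    · simp [hf₁, hg₁, indicator_of_mem (interior_subset (hφK hx)), inner_smul_right]
    · simp [image_eq_zero_of_notMem_tsupport hx]

end Slice

/-! ### Smooth approximation of the truncation at level c. -/

section SmoothTransition

theorem continuous_deriv_smoothTransition : Continuous (deriv Real.smoothTransition) :=
  (Real.smoothTransition.contDiff (n := 1)).continuous_deriv le_rfl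

theorem deriv_smoothTransition_of_lt {x : ℝ} (hx : x < 0) : deriv Real.smoothTransition x = 0 := by
  have : Real.smoothTransition =ᶠ[𝓝 x] fun _ => 0 := by
    filter_upwards [gt_mem_nhds hx] with y hy using Real.smoothTransition.zero_of_nonpos hy.le
  rw [this.deriv_eq, deriv_const]

theorem deriv_smoothTransition_of_one_lt {x : ℝ} (hx : 1 < x) :
    deriv Real.smoothTransition x = 0 := by
  have : Real.smoothTransition =ᶠ[𝓝 x] fun _ => 1 := by
    filter_upwards [lt_mem_nhds hx] with y hy using Real.smoothTransition.one_of_one_le hy.le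
  rw [this.deriv_eq, deriv_const]

theorem hasCompactSupport_deriv_smoothTransition :
    HasCompactSupport (deriv Real.smoothTransition) := by
  refine HasCompactSupport.intro (isCompact_Icc (a := (0 : ℝ)) (b := 1)) fun x hx => ?_
  rcases lt_or_ge x 0 with h | h
  · exact deriv_smoothTransition_of_lt h
  · exact deriv_smoothTransition_of_one_lt (not_le.1 fun h1 => hx ⟨h, h1⟩)

/-- By the scaling in `smoothMax`, this single bound controls its derivative uniformly in j. -/
theorem exists_bound_mul_deriv_smoothTransition :
    ∃ M, ∀ x : ℝ, |x * deriv Real.smoothTransition x| ≤ M :=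
  (hasCompactSupport_deriv_smoothTransition.mul_left
    (f := fun x : ℝ => x)).exists_bound_of_continuous
    (continuous_id.mul continuous_deriv_smoothTransition)

/-- A `C^1` approximation of `s ↦ max s c`. -/
noncomputable def smoothMax (j : ℕ) (c s : ℝ) : ℝ :=
  c + (s - c) * Real.smoothTransition (j * (s - c))

theorem contDiff_smoothMax (j : ℕ) (c : ℝ) : ContDiff ℝ 1 (smoothMax j c) := by
  have : ContDiff ℝ 1 Real.smoothTransition := Real.smoothTransition.contDiff (n := 1)
  unfold smoothMax
  exact contDiff_const.add ((contDiff_id.sub contDiff_const).mul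
    (this.comp (contDiff_const.mul (contDiff_id.sub contDiff_const))))

theorem deriv_smoothMax (j : ℕ) (c s : ℝ) :
    deriv (smoothMax j c) s = Real.smoothTransition (j * (s - c))
      + (j * (s - c)) * deriv Real.smoothTransition (j * (s - c)) := by
  have h1 : HasDerivAt (fun s : ℝ => (j : ℝ) * (s - c)) j s := by
    simpa using ((hasDerivAt_id s).sub_const c).const_mul (j : ℝ)
  have h2 := ((Real.smoothTransition.contDiff (n := 1)).differentiable one_ne_zero
    (j * (s - c))).hasDerivAt.comp s h1
  have h3 := (((hasDerivAt_id s).sub_const c).mul h2).const_add c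
  have h4 : deriv (smoothMax j c) s = _ := h3.deriv
  rw [h4]
  simp only [Function.comp_apply, id]
  ring

theorem tendsto_natCast_mul_atTop {x : ℝ} (hx : 0 < x) :
    ∀ᶠ j : ℕ in atTop, 1 < (j : ℝ) * x :=
  ((tendsto_natCast_atTop_atTop (R := ℝ)).atTop_mul_const hx).eventually_gt_atTop 1

theorem tendsto_smoothMax (c s : ℝ) :
    Tendsto (fun j => smoothMax j c s) atTop (𝓝 (max s c)) := by
  refine tendsto_const_nhds.congr' ?_
  rcases le_or_gt s c with h | h
  · refine Eventually.of_forall fun j => ?_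
    beta_reduce
    rw [smoothMax, Real.smoothTransition.zero_of_nonpos, max_eq_right h, mul_zero, add_zero]
    exact mul_nonpos_of_nonneg_of_nonpos (by positivity) (by linarith)
  · filter_upwards [tendsto_natCast_mul_atTop (sub_pos.2 h)] with j hj
    rw [smoothMax, Real.smoothTransition.one_of_one_le hj.le, max_eq_left h.le]
    ring

/-- At s = c both terms of the derivative vanish, so the limit holds at every s. Hence it is not
necessary to know that the gradient vanishes a.e. on the level set {f = c}. -/
theorem tendsto_deriv_smoothMax (c s : ℝ) :
    Tendsto (fun j => deriv (smoothMax j c) s) atTop (𝓝 (if c < s then 1 else 0)) := by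
  refine tendsto_const_nhds.congr' ?_
  split_ifs with h
  · filter_upwards [tendsto_natCast_mul_atTop (sub_pos.2 h)] with j hj
    rw [deriv_smoothMax, Real.smoothTransition.one_of_one_le hj.le,
      deriv_smoothTransition_of_one_lt hj, mul_zero, add_zero]
  · refine Eventually.of_forall fun j => ?_
    have h0 : (j : ℝ) * (s - c) ≤ 0 :=
      mul_nonpos_of_nonneg_of_nonpos (by positivity) (by linarith [not_lt.1 h])
    beta_reduce
    rw [deriv_smoothMax, Real.smoothTransition.zero_of_nonpos h0]
    rcases h0.lt_or_eq with h1 | h1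
    · rw [deriv_smoothTransition_of_lt h1]; simp
    · rw [h1]; simp

theorem abs_smoothMax_le (j : ℕ) (c s : ℝ) : |smoothMax j c s| ≤ |c| + |s - c| := by
  refine (abs_add_le _ _).trans (add_le_add le_rfl ?_)
  rw [abs_mul, abs_of_nonneg (Real.smoothTransition.nonneg _)]
  exact mul_le_of_le_one_right (abs_nonneg _) (Real.smoothTransition.le_one _)

end SmoothTransition

/-! ### Weak gradient of the maximum with a constant. -/

section Truncation

variable {n : ℕ} {Ω : Set (EuclideanSpace ℝ (Fin n))}
  {f : EuclideanSpace ℝ (Fin n) → ℝ} {g : EuclideanSpace ℝ (Fin n) → EuclideanSpace ℝ (Fin n)}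

/-- Weak gradient of a truncation. -/
theorem HasWeakGradientOn.max_const (hΩ : IsOpen Ω) (h : HasWeakGradientOn Ω f g) (c : ℝ) :
    HasWeakGradientOn Ω (fun x => max (f x) c) (fun x => (if c < f x then 1 else 0 : ℝ) • g x) := by
  obtain ⟨M, hM⟩ := exists_bound_mul_deriv_smoothTransition
  -- A bound independent of j, which supplies the dominating function in the limit of the gradients.
  have hM1 : ∀ j s, |deriv (smoothMax j c) s| ≤ 1 + M := fun j s => by
    rw [deriv_smoothMax]
    refine (abs_add_le _ _).trans (add_le_add ?_ (hM _))
    rw [abs_of_nonneg (Real.smoothTransition.nonneg _)]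
    exact Real.smoothTransition.le_one _
  have hM0 : 0 ≤ 1 + M := (abs_nonneg _).trans (hM1 0 0)
  have hj : ∀ j, HasWeakGradientOn Ω (fun x => smoothMax j c (f x))
      (fun x => deriv (smoothMax j c) (f x) • g x) := fun j =>
    h.comp_contDiff hΩ (contDiff_smoothMax j c) (hM1 j)
  have hfc : LocallyIntegrableOn (fun x => |c| + |f x - c|) Ω := by
    have hc : ∀ a : ℝ, LocallyIntegrableOn (fun _ : EuclideanSpace ℝ (Fin n) => a) Ω := fun a =>
      (locallyIntegrable_const a).locallyIntegrableOn Ω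
    exact (hc _).add (h.locallyIntegrableOn.sub (hc c)).norm
  refine HasWeakGradientOn.of_integral_fderiv ?_ ?_ ?_
  · rw [locallyIntegrableOn_iff hΩ.isLocallyClosed]
    intro K hKΩ hK
    have hfK := h.locallyIntegrableOn.integrableOn_compact_subset hKΩ hK
    have : IsFiniteMeasure (volume.restrict K) := ⟨by simpa using hK.measure_lt_top⟩
    exact Integrable.sup hfK (integrable_const c)
  · rw [locallyIntegrableOn_iff hΩ.isLocallyClosed]
    intro K hKΩ hK
    have hfK := h.locallyIntegrableOn.integrableOn_compact_subset hKΩ hK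
    have hgK := h.locallyIntegrableOn_grad.integrableOn_compact_subset hKΩ hK
    refine Integrable.bdd_smul (φ := fun x => (if c < f x then 1 else 0 : ℝ)) hgK 1 ?_
      (Eventually.of_forall fun x => by split_ifs <;> simp)
    have hm : Measurable fun s : ℝ => (if c < s then 1 else 0 : ℝ) :=
      Measurable.ite measurableSet_Ioi measurable_const measurable_const
    exact (hm.comp_aemeasurable hfK.aestronglyMeasurable.aemeasurable).aestronglyMeasurable
  intro φ hφ e
  have hφe := hφ.continuous_fderiv_apply e
  have hφec := hφ.hasCompactSupport_fderiv_apply e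
  have hφeU := hφ.tsupport_fderiv_apply_subset e
  have h1 : ∀ j, Integrable (fun x => smoothMax j c (f x) * fderiv ℝ φ x e) := fun j => by
    simpa [mul_comm] using LocallyIntegrableOn.integrable_smul_of_hasCompactSupport
      (hj j).locallyIntegrableOn hφe hφec hφeU
  have h2 : ∀ j, Integrable (fun x => φ x * inner ℝ e (deriv (smoothMax j c) (f x) • g x)) :=
    fun j => by
    simpa [inner_smul_right] using (LocallyIntegrableOn.integrable_smul_of_hasCompactSupport
      (hj j).locallyIntegrableOn_grad hφ.smooth.continuous hφ.hasCompactSupport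
      hφ.tsupport_subset).const_inner (𝕜 := ℝ) e
  have hl1 : Tendsto (fun j => ∫ x, smoothMax j c (f x) * fderiv ℝ φ x e) atTop
      (𝓝 (∫ x, max (f x) c * fderiv ℝ φ x e)) := by
    refine tendsto_integral_of_dominated_convergence
      (fun x => ‖fderiv ℝ φ x e • (|c| + |f x - c|)‖) (fun j => (h1 j).aestronglyMeasurable)
      (LocallyIntegrableOn.integrable_smul_of_hasCompactSupport hfc hφe hφec hφeU).norm
      (fun j => Eventually.of_forall fun x => ?_)
      (Eventually.of_forall fun x => (tendsto_smoothMax c (f x)).mul_const _)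
    rw [norm_mul, norm_smul, mul_comm]
    gcongr
    exact (abs_smoothMax_le j c (f x)).trans (le_abs_self _)
  have hl2 : Tendsto (fun j => ∫ x, φ x * inner ℝ e (deriv (smoothMax j c) (f x) • g x)) atTop
      (𝓝 (∫ x, φ x * inner ℝ e ((if c < f x then 1 else 0 : ℝ) • g x))) := by
    refine tendsto_integral_of_dominated_convergence
      (fun x => (1 + M) * ‖inner ℝ e (φ x • g x)‖) (fun j => (h2 j).aestronglyMeasurable)
      (((LocallyIntegrableOn.integrable_smul_of_hasCompactSupport h.locallyIntegrableOn_grad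
        hφ.smooth.continuous hφ.hasCompactSupport hφ.tsupport_subset).const_inner (𝕜 := ℝ) e).norm.const_mul
        _) (fun j => Eventually.of_forall fun x => ?_)
      (Eventually.of_forall fun x => ?_)
    · rw [inner_smul_right, inner_smul_right, ← mul_assoc, mul_comm (φ x), mul_assoc, norm_mul]
      gcongr
      exact hM1 j _
    · simp only [inner_smul_right]
      exact ((tendsto_deriv_smoothMax c (f x)).mul_const _).const_mul _
  refine tendsto_nhds_unique (hl1.congr fun j => ?_) hl2.neg
  exact (hj j).integral_fderiv hφ e

end Truncation

/-! ### The signed power and the dual exponent. -/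

section SignedPower

variable {p : ℝ}

/-- The signed power `|s|^{p-2} s`. -/
noncomputable def signedPow (p s : ℝ) : ℝ := |s| ^ (p - 2) * s

theorem signedPow_of_nonneg (hp : 1 < p) {s : ℝ} (hs : 0 ≤ s) : signedPow p s = s ^ (p - 1) := by
  rcases hs.eq_or_lt with rfl | h
  · rw [signedPow, mul_zero, Real.zero_rpow (by linarith)]
  · rw [signedPow, abs_of_pos h, show p - 1 = p - 2 + 1 by ring, Real.rpow_add_one h.ne']

theorem signedPow_neg (p s : ℝ) : signedPow p (-s) = -signedPow p s := by
  simp [signedPow]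

theorem signedPow_zero (p : ℝ) : signedPow p 0 = 0 := by simp [signedPow]

theorem strictMono_signedPow (hp : 1 < p) : StrictMono (signedPow p) := by
  refine strictMono_of_odd_strictMonoOn_nonneg (signedPow_neg p) fun x hx y hy hxy => ?_
  rw [signedPow_of_nonneg hp hx, signedPow_of_nonneg hp hy]
  exact Real.rpow_lt_rpow hx hxy (by linarith)

theorem measurable_signedPow (p : ℝ) : Measurable (signedPow p) := by
  unfold signedPow; fun_prop

theorem norm_rpow_smul_self {F : Type*} [NormedAddCommGroup F] [NormedSpace ℝ F] (hp : 1 < p)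
    (ξ : F) : ‖‖ξ‖ ^ (p - 2) • ξ‖ = ‖ξ‖ ^ (p - 1) := by
  rw [norm_smul, Real.norm_of_nonneg (by positivity), ← signedPow_of_nonneg hp (norm_nonneg ξ),
    signedPow, abs_norm]

theorem norm_signedPow (hp : 1 < p) (s : ℝ) : ‖signedPow p s‖ = ‖s‖ ^ (p - 1) :=
  norm_rpow_smul_self (F := ℝ) hp s

/-- Since p/(p-1) is the conjugate exponent, both |u|^{p-2}u and the flux |∇u|^{p-2}∇u lie in the
dual space and pair with L^p test functions. -/
theorem memLp_of_norm_eq_rpow {α F F' : Type*} [MeasurableSpace α] {μ : Measure α}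
    [NormedAddCommGroup F] [NormedAddCommGroup F'] (hp : 1 < p) {f : α → F} {h : α → F'}
    (hf : MemLp f (ENNReal.ofReal p) μ) (hh : AEStronglyMeasurable h μ)
    (hfh : ∀ x, ‖h x‖ = ‖f x‖ ^ (p - 1)) : MemLp h (ENNReal.ofReal p.conjExponent) μ := by
  have h1 := hf.norm_rpow_div (ENNReal.ofReal (p - 1))
  rw [← ENNReal.ofReal_div_of_pos (by linarith), ENNReal.toReal_ofReal (by linarith)] at h1
  refine h1.congr_norm hh (Eventually.of_forall fun x => ?_)
  rw [hfh, Real.norm_of_nonneg (by positivity)]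

end SignedPower

/-! ### The cutoff H and its convex primitive G. -/

section Cutoff

variable {p c : ℝ}

/-- A smooth approximation of the indicator of `{s | c < s}`, as a function of
`signedPow p s`. -/
noncomputable def cutoff (p c : ℝ) (j : ℕ) (s : ℝ) : ℝ :=
  Real.smoothTransition (j * (signedPow p s - signedPow p c))

theorem cutoff_nonneg (p c : ℝ) (j : ℕ) (s : ℝ) : 0 ≤ cutoff p c j s :=
  Real.smoothTransition.nonneg _

theorem cutoff_le_one (p c : ℝ) (j : ℕ) (s : ℝ) : cutoff p c j s ≤ 1 :=
  Real.smoothTransition.le_one _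

theorem monotone_cutoff (hp : 1 < p) (c : ℝ) (j : ℕ) : Monotone (cutoff p c j) := fun s t hst =>
  Real.smoothTransition.monotone <| mul_le_mul_of_nonneg_left
    (sub_le_sub_right ((strictMono_signedPow hp).monotone hst) _) (by positivity)

theorem cutoff_of_le (hp : 1 < p) (j : ℕ) {s : ℝ} (hs : s ≤ c) : cutoff p c j s = 0 :=
  Real.smoothTransition.zero_of_nonpos <| mul_nonpos_of_nonneg_of_nonpos (by positivity)
    (sub_nonpos.2 ((strictMono_signedPow hp).monotone hs))

/-- Below c the cutoff is locally zero; from c on, s is positive and the signed power is smooth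
there. Positivity of c keeps the singularity at the origin inside the zero region. -/
theorem contDiff_cutoff (hp : 1 < p) (hc : 0 < c) (j : ℕ) : ContDiff ℝ 1 (cutoff p c j) := by
  refine contDiff_iff_contDiffAt.2 fun s => ?_
  rcases lt_or_ge s c with h | h
  · refine contDiffAt_const (c := (0 : ℝ)) |>.congr_of_eventuallyEq ?_
    filter_upwards [gt_mem_nhds h] with t ht using cutoff_of_le hp j ht.le
  · have hs : 0 < s := hc.trans_le h
    have h1 : ContDiffAt ℝ 1 (signedPow p) s := by
      refine (Real.contDiffAt_rpow_const_of_ne (p := p - 1) hs.ne').congr_of_eventuallyEq ?_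
      filter_upwards [lt_mem_nhds hs] with t ht using signedPow_of_nonneg hp ht.le
    exact (Real.smoothTransition.contDiffAt (n := 1)).comp s
      (contDiffAt_const.mul (h1.sub contDiffAt_const))

theorem deriv_cutoff_nonneg (hp : 1 < p) (c : ℝ) (j : ℕ) (s : ℝ) : 0 ≤ deriv (cutoff p c j) s :=
  (monotone_cutoff hp c j).deriv_nonneg

theorem exists_bound_deriv_cutoff (hp : 1 < p) (hc : 0 < c) (j : ℕ) :
    ∃ C, ∀ s, |deriv (cutoff p c j) s| ≤ C := by
  have hk : 0 ≤ signedPow p c + 1 := by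
    rw [signedPow_of_nonneg hp hc.le]; positivity
  -- `m` is the point where the signed power has risen by 1 above its value at c. For j ≥ 1 the
  -- cutoff equals 1 beyond it, so its derivative lives in [c, m]; for j = 0 the cutoff is
  -- identically zero.
  set m := (signedPow p c + 1) ^ (p - 1)⁻¹ with hm
  have hbm : signedPow p m = signedPow p c + 1 := by
    rw [signedPow_of_nonneg hp (by positivity), hm, Real.rpow_inv_rpow hk (by linarith)]
  refine HasCompactSupport.exists_bound_of_continuous
    (HasCompactSupport.intro (isCompact_Icc (a := c) (b := m)) fun s hs => ?_)
    ((contDiff_cutoff hp hc j).continuous_deriv le_rfl)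
  rcases lt_or_ge s c with h | h
  · have : cutoff p c j =ᶠ[𝓝 s] fun _ => 0 := by
      filter_upwards [gt_mem_nhds h] with t ht using cutoff_of_le hp j ht.le
    rw [this.deriv_eq, deriv_const]
  · have hms : m < s := not_le.1 fun h1 => hs ⟨h, h1⟩
    rcases Nat.eq_zero_or_pos j with rfl | hj
    · have : cutoff p c 0 = fun _ => 0 := by
        funext t; simp [cutoff]
      rw [this, deriv_const]
    · have : cutoff p c j =ᶠ[𝓝 s] fun _ => 1 := by
        filter_upwards [lt_mem_nhds hms] with t ht
        refine Real.smoothTransition.one_of_one_le ?_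
        have h1 := strictMono_signedPow hp ht
        have h2 : (1 : ℝ) ≤ j := by exact_mod_cast hj
        nlinarith
      rw [this.deriv_eq, deriv_const]

theorem tendsto_cutoff (hp : 1 < p) (c s : ℝ) :
    Tendsto (fun j => cutoff p c j s) atTop (𝓝 (if c < s then 1 else 0)) := by
  refine tendsto_const_nhds.congr' ?_
  split_ifs with h
  · filter_upwards [tendsto_natCast_mul_atTop (sub_pos.2 (strictMono_signedPow hp h))] with j hj
    exact (Real.smoothTransition.one_of_one_le hj.le).symm
  · exact Eventually.of_forall fun j => (cutoff_of_le hp j (not_lt.1 h)).symm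

/-- A convex approximation of `y ↦ max y k - k`. -/
noncomputable def softPosPart (k : ℝ) (j : ℕ) (y : ℝ) : ℝ :=
  ∫ x in k..y, Real.smoothTransition (j * (x - k))

theorem intervalIntegrable_smoothTransition (k : ℝ) (j : ℕ) (x y : ℝ) :
    IntervalIntegrable (fun x => Real.smoothTransition (j * (x - k))) volume x y :=
  (Real.smoothTransition.continuous.comp (by fun_prop)).intervalIntegrable _ _

/-- The integrand is nondecreasing, so the primitive is convex and lies above its tangent line at y.
The slope is taken at the endpoint y because the cutoff is later evaluated at the present time, the
difference being backward. -/
theorem softPosPart_sub_le (k : ℝ) (j : ℕ) (x y : ℝ) :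
    softPosPart k j y - softPosPart k j x ≤ (y - x) * Real.smoothTransition (j * (y - k)) := by
  have hI := intervalIntegrable_smoothTransition k j
  have hmono : ∀ a b : ℝ, a ≤ b →
      Real.smoothTransition (j * (a - k)) ≤ Real.smoothTransition (j * (b - k)) := fun a b hab =>
    Real.smoothTransition.monotone (by gcongr)
  rw [softPosPart, softPosPart, intervalIntegral.integral_interval_sub_left (hI _ _) (hI _ _)]
  rcases le_total x y with h | h
  · have := intervalIntegral.integral_mono_on h (hI x y)
      (intervalIntegrable_const (c := Real.smoothTransition (j * (y - k))))
      fun z hz => hmono z y hz.2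
    simpa using this
  · have := intervalIntegral.integral_mono_on h
      (intervalIntegrable_const (c := Real.smoothTransition (j * (y - k)))) (hI y x)
      fun z hz => hmono y z hz.1
    rw [intervalIntegral.integral_symm]
    rw [intervalIntegral.integral_const, smul_eq_mul] at this
    linarith

theorem softPosPart_of_le {k y : ℝ} (j : ℕ) (hy : y ≤ k) : softPosPart k j y = 0 := by
  rw [softPosPart, intervalIntegral.integral_symm, neg_eq_zero]
  refine intervalIntegral.integral_zero_ae (Eventually.of_forall fun x hx => ?_)
  rw [uIoc_of_le hy] at hx
  exact Real.smoothTransition.zero_of_nonpos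
    (mul_nonpos_of_nonneg_of_nonpos (by positivity) (sub_nonpos.2 hx.2))

theorem monotone_softPosPart (k : ℝ) (j : ℕ) : Monotone (softPosPart k j) := fun x y hxy => by
  have := softPosPart_sub_le k j y x
  have h2 : (x - y) * Real.smoothTransition (j * (x - k)) ≤ 0 :=
    mul_nonpos_of_nonpos_of_nonneg (by linarith) (Real.smoothTransition.nonneg _)
  linarith

theorem abs_softPosPart_le {k : ℝ} (hk : 0 ≤ k) (j : ℕ) (y : ℝ) : |softPosPart k j y| ≤ |y| := by
  rcases le_total y k with h | h
  · rw [softPosPart_of_le j h, abs_zero]; exact abs_nonneg _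
  · have h0 : 0 ≤ softPosPart k j y := by
      rw [← softPosPart_of_le (k := k) j le_rfl]; exact monotone_softPosPart k j h
    have h1 := softPosPart_sub_le k j k y
    rw [softPosPart_of_le j le_rfl, sub_zero] at h1
    have h2 : (y - k) * Real.smoothTransition (j * (y - k)) ≤ y - k :=
      mul_le_of_le_one_right (by linarith) (Real.smoothTransition.le_one _)
    rw [abs_of_nonneg h0, abs_of_nonneg (hk.trans h)]
    linarith

theorem tendsto_softPosPart (k y : ℝ) :
    Tendsto (fun j => softPosPart k j y) atTop (𝓝 (max y k - k)) := by
  rcases le_or_gt y k with h | h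
  · rw [max_eq_right h, sub_self]
    exact tendsto_const_nhds.congr fun j => (softPosPart_of_le j h).symm
  · rw [max_eq_left h.le]
    have h1 : y - k = ∫ x in k..y, (1 : ℝ) := by simp
    rw [h1]
    refine intervalIntegral.tendsto_integral_filter_of_dominated_convergence (fun _ => 1)
      (Eventually.of_forall fun j => (Real.smoothTransition.continuous.comp
        (by fun_prop)).aestronglyMeasurable)
      (Eventually.of_forall fun j => Eventually.of_forall fun x _ => ?_)
      intervalIntegrable_const (Eventually.of_forall fun x hx => ?_)
    · rw [Real.norm_of_nonneg (Real.smoothTransition.nonneg _)]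
      exact Real.smoothTransition.le_one _
    · rw [uIoc_of_le h.le] at hx
      refine tendsto_const_nhds.congr' ?_
      filter_upwards [tendsto_natCast_mul_atTop (sub_pos.2 hx.1)] with j hj
      exact (Real.smoothTransition.one_of_one_le hj.le).symm

end Cutoff

/-! ### Space-time test functions and the discrete time inequality. -/

section SpaceTime

variable {n : ℕ}

local notation "𝔼" => EuclideanSpace ℝ (Fin n)

instance isAddHaarMeasure_volume_spaceTime : (volume : Measure (𝔼 × ℝ)).IsAddHaarMeasure :=
  Measure.prod.instIsAddHaarMeasure _ _

/-- The gradient in the space variable. -/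
noncomputable def spaceGradient (η : 𝔼 × ℝ → ℝ) (z : 𝔼 × ℝ) : 𝔼 :=
  (InnerProductSpace.toDual ℝ 𝔼).symm ((fderiv ℝ η z).comp (ContinuousLinearMap.inl ℝ 𝔼 ℝ))

theorem inner_spaceGradient (η : 𝔼 × ℝ → ℝ) (z : 𝔼 × ℝ) (e : 𝔼) :
    inner ℝ e (spaceGradient η z) = fderiv ℝ η z (e, 0) := by
  rw [real_inner_comm, spaceGradient, InnerProductSpace.toDual_symm_apply]
  simp

theorem spaceGradient_eq_zero {η : 𝔼 × ℝ → ℝ} {z : 𝔼 × ℝ} (hz : z ∉ tsupport η) :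
    spaceGradient η z = 0 := by
  have : fderiv ℝ η z = 0 := by
    by_contra h0
    exact hz (support_fderiv_subset ℝ h0)
  simp [spaceGradient, this]

theorem fderiv_slice {η : 𝔼 × ℝ → ℝ} (hη : Differentiable ℝ η) (x e : 𝔼) (t : ℝ) :
    fderiv ℝ (fun y => η (y, t)) x e = fderiv ℝ η (x, t) (e, 0) := by
  have h := (hη (x, t)).hasFDerivAt.comp x (hasFDerivAt_prodMk_left (𝕜 := ℝ) x t)
  have h2 : fderiv ℝ (fun y => η (y, t)) x = _ := h.fderiv
  rw [h2]; simp

theorem gradient_slice {η : 𝔼 × ℝ → ℝ} (hη : Differentiable ℝ η) (z : 𝔼 × ℝ) :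
    gradient (fun y => η (y, z.2)) z.1 = spaceGradient η z := by
  refine ext_inner_left ℝ fun e => ?_
  rw [inner_spaceGradient, real_inner_comm, inner_gradient_left, fderiv_slice hη]

theorem deriv_slice {η : 𝔼 × ℝ → ℝ} (hη : Differentiable ℝ η) (z : 𝔼 × ℝ) :
    deriv (fun s => η (z.1, s)) z.2 = fderiv ℝ η z (0, 1) := by
  have h := (hη z).hasFDerivAt.comp_hasDerivAt z.2
    (((hasDerivAt_const z.2 z.1).prodMk (hasDerivAt_id z.2)))
  exact h.deriv

theorem continuous_spaceGradient {η : 𝔼 × ℝ → ℝ} (hη : ContDiff ℝ ∞ η) :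
    Continuous (spaceGradient η) :=
  (InnerProductSpace.toDual ℝ 𝔼).symm.continuous.comp
    ((hη.continuous_fderiv (by simp)).clm_comp continuous_const)

theorem hasCompactSupport_spaceGradient {η : 𝔼 × ℝ → ℝ} (hη : HasCompactSupport η) :
    HasCompactSupport (spaceGradient η) :=
  HasCompactSupport.intro hη fun _ hz => spaceGradient_eq_zero hz

theorem spaceGradient_comp_sub (η : 𝔼 × ℝ → ℝ) (z a : 𝔼 × ℝ) :
    spaceGradient (fun z => η (z - a)) z = spaceGradient η (z - a) := by
  rw [spaceGradient, spaceGradient, fderiv_comp_sub]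

theorem isTestFunction_slice {Ω : Set 𝔼} {T : ℝ} {η : 𝔼 × ℝ → ℝ}
    (hη : IsTestFunction (cylinder Ω T) η) (t : ℝ) : IsTestFunction Ω (fun x => η (x, t)) := by
  have hcl : IsClosedEmbedding fun x : 𝔼 => (x, t) :=
    ⟨isEmbedding_prodMkLeft t, by
      have : range (fun x : 𝔼 => (x, t)) = Prod.snd ⁻¹' {t} := by
        ext ⟨a, b⟩; simp [eq_comm]
      rw [this]
      exact isClosed_singleton.preimage continuous_snd⟩
  refine ⟨hη.smooth.comp (by fun_prop), hη.hasCompactSupport.comp_isClosedEmbedding hcl, ?_⟩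
  refine (closure_minimal (fun x hx => subset_tsupport η hx)
    ((isClosed_tsupport η).preimage hcl.continuous) : tsupport (fun x => η (x, t)) ⊆
      (fun x : 𝔼 => (x, t)) ⁻¹' tsupport η).trans fun x hx => ?_
  exact (hη.tsupport_subset hx).1

/-- A compact Q lies in the product of its spatial projection with the interval between its extreme
times. These times are attained on Q, hence lie strictly inside (0, T). -/
theorem memLp_restrict_of_isCompact {F : Type*} [NormedAddCommGroup F] {p : ENNReal} {Ω : Set 𝔼}
    {T : ℝ} {v : 𝔼 × ℝ → F}
    (hv : ∀ K : Set 𝔼, IsCompact K → K ⊆ Ω → ∀ t₁ t₂ : ℝ, 0 < t₁ → t₂ < T →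
      MemLp v p (volume.restrict (K ×ˢ Icc t₁ t₂)))
    {Q : Set (𝔼 × ℝ)} (hQ : IsCompact Q) (hQΩ : Q ⊆ cylinder Ω T) :
    MemLp v p (volume.restrict Q) := by
  rcases Q.eq_empty_or_nonempty with rfl | hne
  · simp
  have h2 : IsCompact (Prod.snd '' Q) := hQ.image continuous_snd
  have hne2 : (Prod.snd '' Q).Nonempty := hne.image _
  obtain ⟨z₁, hz₁, hz₁e⟩ := h2.sInf_mem hne2
  obtain ⟨z₂, hz₂, hz₂e⟩ := h2.sSup_mem hne2
  refine (hv (Prod.fst '' Q) (hQ.image continuous_fst) ?_ z₁.2 z₂.2 (hQΩ hz₁).2.1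
    (hQΩ hz₂).2.2).mono_measure (Measure.restrict_mono ?_ le_rfl)
  · rintro _ ⟨z, hz, rfl⟩
    exact (hQΩ hz).1
  · intro z hz
    refine ⟨mem_image_of_mem _ hz, ?_, ?_⟩
    · rw [hz₁e]; exact csInf_le h2.bddBelow (mem_image_of_mem _ hz)
    · rw [hz₂e]; exact le_csSup h2.bddAbove (mem_image_of_mem _ hz)

/-- The product of a test function and a `C^1` function of `u` has the expected weak space gradient
in space-time. -/
theorem integral_mul_comp_mul_fderiv_eq {Ω : Set 𝔼} (hΩ : IsOpen Ω) {T : ℝ}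
    {u : 𝔼 × ℝ → ℝ} {Du : 𝔼 × ℝ → 𝔼}
    (hu : ∀ᵐ t ∂(volume.restrict (Ioo 0 T)),
      HasWeakGradientOn Ω (fun x => u (x, t)) (fun x => Du (x, t)))
    {η : 𝔼 × ℝ → ℝ} (hη : IsTestFunction (cylinder Ω T) η)
    {ζ : ℝ → ℝ} (hζ : ContDiff ℝ 1 ζ) {C : ℝ} (hC : ∀ s, |deriv ζ s| ≤ C)
    {ψ : 𝔼 × ℝ → ℝ} (hψ : ∀ z, ψ z = η z * ζ (u z))
    {Dψ : 𝔼 × ℝ → 𝔼}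
    (hDψ : ∀ z, Dψ z = ζ (u z) • spaceGradient η z + (η z * deriv ζ (u z)) • Du z)
    (hψi : Integrable ψ) (hDψi : Integrable Dψ)
    {θ : 𝔼 × ℝ → ℝ} (hθ : ContDiff ℝ ∞ θ) (hθc : HasCompactSupport θ) (e : 𝔼) :
    ∫ z, ψ z * fderiv ℝ θ z (e, 0) = -∫ z, θ z * inner ℝ e (Dψ z) := by
  have hθe : Continuous fun z => fderiv ℝ θ z (e, 0) :=
    (hθ.continuous_fderiv (by simp)).clm_apply continuous_const
  obtain ⟨C₁, hC₁⟩ := (hθc.fderiv_apply (𝕜 := ℝ) (e, 0)).exists_bound_of_continuous hθe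
  obtain ⟨C₂, hC₂⟩ := hθc.exists_bound_of_continuous hθ.continuous
  have h1 : Integrable fun z => ψ z * fderiv ℝ θ z (e, 0) :=
    hψi.mul_bdd (c := C₁) hθe.aestronglyMeasurable (Eventually.of_forall hC₁)
  have h2 : Integrable fun z => θ z * inner ℝ e (Dψ z) :=
    (hDψi.const_inner (𝕜 := ℝ) e).bdd_mul (c := C₂) hθ.continuous.aestronglyMeasurable
      (Eventually.of_forall hC₂)
  rw [eq_neg_iff_add_eq_zero, ← integral_add h1 h2, Measure.volume_eq_prod]
  refine (integral_prod_symm _ (h1.add h2)).trans ?_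
  simp only [Pi.add_apply]
  refine integral_eq_zero_of_ae ?_
  rw [ae_restrict_iff' measurableSet_Ioo] at hu
  filter_upwards [hu] with t ht
  by_cases htT : t ∈ Ioo 0 T
  · have h := (ht htT).comp_contDiff hΩ hζ hC
    have hηt := isTestFunction_slice hη t
    have hθt : ContDiff ℝ ∞ fun x : 𝔼 => θ (x, t) := hθ.comp (by fun_prop)
    -- Since η localizes to the cylinder, θη is an admissible test function on each slice although θ
    -- is arbitrary. The chain rule tested with it is exactly the slice of the claim.
    have hφ : IsTestFunction Ω (fun x : 𝔼 => θ (x, t) * η (x, t)) :=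
      ⟨hθt.mul hηt.smooth, hηt.hasCompactSupport.mul_left,
        (tsupport_mul_subset_right).trans hηt.tsupport_subset⟩
    have hi := h.integral_fderiv hφ e
    rw [eq_neg_iff_add_eq_zero, ← integral_add] at hi
    · refine Eq.trans ?_ hi
      refine integral_congr_ae (Eventually.of_forall fun x => ?_)
      have hprod : fderiv ℝ (fun x : 𝔼 => θ (x, t) * η (x, t)) x e
          = θ (x, t) * fderiv ℝ η (x, t) (e, 0) + η (x, t) * fderiv ℝ θ (x, t) (e, 0) := by
        have hd := ((hθt.differentiable (by simp)) x).hasFDerivAt.mul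
          ((hηt.smooth.differentiable (by simp)) x).hasFDerivAt
        have hd2 : fderiv ℝ (fun x : 𝔼 => θ (x, t) * η (x, t)) x = _ := hd.fderiv
        rw [hd2]
        simp [fderiv_slice (hθ.differentiable (by simp)),
          fderiv_slice (hη.smooth.differentiable (by simp))]
      simp only [hprod, hψ, hDψ, inner_add_right, inner_smul_right, inner_spaceGradient]
      ring
    · simpa [mul_comm] using LocallyIntegrableOn.integrable_smul_of_hasCompactSupport
        h.locallyIntegrableOn (hφ.continuous_fderiv_apply e) (hφ.hasCompactSupport_fderiv_apply e)
        (hφ.tsupport_fderiv_apply_subset e)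
    · simpa [inner_smul_right] using (LocallyIntegrableOn.integrable_smul_of_hasCompactSupport
        h.locallyIntegrableOn_grad hφ.smooth.continuous hφ.hasCompactSupport
        hφ.tsupport_subset).const_inner (𝕜 := ℝ) e
  · have hz : ∀ x : 𝔼, (x, t) ∉ tsupport η := fun x hx => htT (hη.tsupport_subset hx).2
    rw [Pi.zero_apply]
    refine integral_eq_zero_of_ae (Eventually.of_forall fun x => ?_)
    simp [hψ, hDψ, image_eq_zero_of_notMem_tsupport (hz x), spaceGradient_eq_zero (hz x)]

theorem spaceGradient_convolution {ψ : 𝔼 × ℝ → ℝ} {Dψ : 𝔼 × ℝ → 𝔼} (hψi : Integrable ψ)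
    (hDψi : Integrable Dψ)
    (hW : ∀ θ : 𝔼 × ℝ → ℝ, ContDiff ℝ ∞ θ → HasCompactSupport θ → ∀ e : 𝔼,
      ∫ z, ψ z * fderiv ℝ θ z (e, 0) = -∫ z, θ z * inner ℝ e (Dψ z))
    {ρ : 𝔼 × ℝ → ℝ} (hρ : ContDiff ℝ ∞ ρ) (hρc : HasCompactSupport ρ) (z : 𝔼 × ℝ) :
    spaceGradient (ρ ⋆[ContinuousLinearMap.lsmul ℝ ℝ, volume] ψ) z
      = (ρ ⋆[ContinuousLinearMap.lsmul ℝ ℝ, volume] Dψ) z := by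
  refine ext_inner_left ℝ fun e => ?_
  rw [inner_spaceGradient, fderiv_convolution_apply hρ hρc hψi.locallyIntegrable,
    convolution_lsmul_swap, ← integral_inner]
  · have h := hW (fun y => ρ (z - y)) (hρ.comp (by fun_prop))
      (hρc.comp_homeomorph (Homeomorph.subLeft z)) e
    simp only [fderiv_comp_const_sub (hρ.differentiable (by simp)), mul_neg, integral_neg,
      neg_inj] at h
    simpa [inner_smul_right] using h
  · exact (hρc.convolutionExists_left (ContinuousLinearMap.lsmul ℝ ℝ) hρ.continuous
      hDψi.locallyIntegrable z).integrable_swap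

theorem convolution_translate {F : Type*} [NormedAddCommGroup F] [NormedSpace ℝ F]
    (ρ : 𝔼 × ℝ → ℝ) (g : 𝔼 × ℝ → F) (z a : 𝔼 × ℝ) :
    (ρ ⋆[ContinuousLinearMap.lsmul ℝ ℝ, volume] fun z => g (z - a)) z
      = (ρ ⋆[ContinuousLinearMap.lsmul ℝ ℝ, volume] g) (z - a) := by
  simp only [convolution_lsmul, sub_right_comm]

/-- Testing with a nonsmooth test function: a discrete time derivative controls the flux term. -/
theorem exists_translate_sub_le {p q : ℝ} (hpq : p.HolderConjugate q)
    {v : 𝔼 × ℝ → ℝ} {A : 𝔼 × ℝ → 𝔼} {ψ : 𝔼 × ℝ → ℝ} {Dψ : 𝔼 × ℝ → 𝔼}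
    (hv : MemLp v (ENNReal.ofReal p)) (hvi : Integrable v)
    (hA : MemLp A (ENNReal.ofReal p)) (hAi : Integrable A)
    (hψ : MemLp ψ (ENNReal.ofReal q)) (hψi : Integrable ψ)
    (hDψ : MemLp Dψ (ENNReal.ofReal q)) (hDψi : Integrable Dψ)
    (hW : ∀ θ : 𝔼 × ℝ → ℝ, ContDiff ℝ ∞ θ → HasCompactSupport θ → ∀ e : 𝔼,
      ∫ z, ψ z * fderiv ℝ θ z (e, 0) = -∫ z, θ z * inner ℝ e (Dψ z))
    (hψ0 : ∀ z, 0 ≤ ψ z) {Q : Set (𝔼 × ℝ)} {r : ℝ} (hr : 0 < r)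
    (hψc : HasCompactSupport ψ) (hrQ : Metric.cthickening r (tsupport ψ) ⊆ Q)
    (hsub : ∀ φ : 𝔼 × ℝ → ℝ, IsTestFunction Q φ → (∀ z, 0 ≤ φ z) →
      ∫ z, (-(v z * fderiv ℝ φ z (0, 1)) + inner ℝ (A z) (spaceGradient φ z)) ≤ 0)
    {κ : ℝ} (hκ : 0 < κ) :
    ∃ h₀ > 0, ∀ h : ℝ, 0 < h → h < h₀ →
      (∫ z, v z * ψ z) - ∫ z, v z * ψ (z - (-h) • ((0, 1) : 𝔼 × ℝ))
        ≤ -((∫ z, inner ℝ (A z) (Dψ z)) - κ) * h := by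
  set ι : 𝔼 × ℝ := (0, 1) with hι
  have hιn : ‖ι‖ = 1 := by simp [hι, Prod.norm_def]
  set E : 𝔼 × ℝ → ℝ := fun a => ∫ z, inner ℝ (A z) (Dψ (z - a)) with hE
  set V : 𝔼 × ℝ → ℝ := fun a => ∫ z, v z * ψ (z - a) with hV
  have hEc : Continuous E := continuous_integral_bilin_translate hpq (innerSL ℝ) hA hDψ
  have hVc : Continuous V :=
    continuous_integral_bilin_translate hpq (ContinuousLinearMap.mul ℝ ℝ) hv hψ
  have hE0 : E 0 = ∫ z, inner ℝ (A z) (Dψ z) := by simp [hE]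
  -- Within distance `r₁` of the origin a translation lowers the flux pairing by less than κ. The
  -- time shift and the mollification radius each get half of `R`, so their sum respects both `r`
  -- and `r₁`.
  obtain ⟨r₁, hr₁, hr₁E⟩ := Metric.eventually_nhds_iff_ball.1
    (hEc.continuousAt.eventually (lt_mem_nhds (sub_lt_self (E 0) hκ)))
  set R := min r r₁ with hR
  have hR0 : 0 < R := lt_min hr hr₁
  refine ⟨R / 2, by positivity, fun h hh hhR => ?_⟩
  let ρ : ℕ → 𝔼 × ℝ → ℝ := fun j => (bump (𝔼 × ℝ) j).normed volume
  have hρ : ∀ j, ContDiff ℝ ∞ (ρ j) := fun j => (bump (𝔼 × ℝ) j).contDiff_normed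
  have hρc : ∀ j, HasCompactSupport (ρ j) := fun j => (bump (𝔼 × ℝ) j).hasCompactSupport_normed
  let φ : ℕ → 𝔼 × ℝ → ℝ := fun j => ρ j ⋆[ContinuousLinearMap.lsmul ℝ ℝ, volume] ψ
  have hφs : ∀ j, ContDiff ℝ ∞ (φ j) := fun j =>
    (hρc j).contDiff_convolution_left _ (hρ j) hψi.locallyIntegrable
  have hφc : ∀ j, HasCompactSupport (φ j) := fun j => (hρc j).convolution _ hψc
  have hVφ : ∀ j (a : 𝔼 × ℝ), ∫ z, v z * φ j (z - a) = ∫ w, ρ j w * V (w + a) := fun j a => by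
    have := integral_bilin_convolution hpq (ContinuousLinearMap.mul ℝ ℝ) hv
      (hψ.comp_measurePreserving (measurePreserving_sub_right volume a)) (hρ j).continuous (hρc j)
    rw [show (ψ ∘ fun x => x - a) = fun x => ψ (x - a) from rfl] at this
    simp only [convolution_translate, ContinuousLinearMap.mul_apply', sub_sub] at this
    exact this
  have hEφ : ∀ j (a : 𝔼 × ℝ), ∫ z, inner ℝ (A z) (spaceGradient (φ j) (z - a))
      = ∫ w, ρ j w * E (w + a) := fun j a => by
    have := integral_bilin_convolution hpq (innerSL ℝ) hA
      (hDψ.comp_measurePreserving (measurePreserving_sub_right volume a)) (hρ j).continuous (hρc j)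
    rw [show (Dψ ∘ fun x => x - a) = fun x => Dψ (x - a) from rfl] at this
    simp only [convolution_translate, sub_sub] at this
    simp only [φ, spaceGradient_convolution hψi hDψi hW (hρ j) (hρc j)]
    exact this
  have hlim : ∀ a, Tendsto (fun j => ∫ z, v z * φ j (z - a)) atTop (𝓝 (V a)) := fun a => by
    simp only [hVφ]
    have := tendsto_integral_bump_mul (μ := (volume : Measure (𝔼 × ℝ)))
      (N := fun w => V (w + a)) (hVc.comp (by fun_prop))
    simpa using this
  have hstep : ∀ᶠ j in atTop, (∫ z, v z * φ j (z - (0 : ℝ) • ι)) - ∫ z, v z * φ j (z - (-h) • ι)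
      ≤ -(E 0 - κ) * h := by
    filter_upwards [(tendsto_bump_rOut (G := 𝔼 × ℝ)).eventually (gt_mem_nhds (half_pos hR0))]
      with j hj
    have hderiv : ∀ τ : ℝ, HasDerivAt (fun τ : ℝ => ∫ z, v z * φ j (z - τ • ι))
        (-∫ z, v z * fderiv ℝ (φ j) (z - τ • ι) ι) τ := fun τ =>
      hasDerivAt_integral_mul_translate hvi (hφs j) (hφc j) ι τ
    -- The shifted mollification is admissible, so the subsolution inequality bounds the time
    -- pairing by the flux pairing, which is an average of values of `E` near the origin.
    have hle : ∀ τ ∈ Icc (-h) 0, -∫ z, v z * fderiv ℝ (φ j) (z - τ • ι) ι ≤ -(E 0 - κ) := by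
      intro τ hτ
      have hτn : ‖τ • ι‖ ≤ h := by
        rw [norm_smul, hιn, mul_one, Real.norm_eq_abs, abs_le]
        exact ⟨hτ.1, hτ.2.trans hh.le⟩
      have hρ0 : ∀ w, ρ j w ≠ 0 → ‖w‖ < R / 2 := fun w hw => by
        have : w ∈ Function.support (ρ j) := hw
        rw [(bump (𝔼 × ℝ) j).support_normed_eq, mem_ball_zero_iff] at this
        exact this.trans hj
      have htest : IsTestFunction Q (fun z => φ j (z - τ • ι)) := by
        refine ⟨(hφs j).comp (by fun_prop),
          (hφc j).comp_homeomorph (Homeomorph.subRight (τ • ι)), ?_⟩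
        refine (closure_minimal (fun z hz => ?_) Metric.isClosed_cthickening).trans hrQ
        have hz' : φ j (z - τ • ι) ≠ 0 := hz
        obtain ⟨w, hw⟩ : ∃ w, ρ j w • ψ (z - τ • ι - w) ≠ 0 := by
          by_contra hcon
          push Not at hcon
          exact hz' (by simp only [φ, convolution_lsmul, hcon, integral_zero])
        have hw1 := hρ0 w (left_ne_zero_of_smul hw)
        refine Metric.mem_cthickening_of_dist_le _ (z - τ • ι - w) _ _
          (subset_tsupport _ (right_ne_zero_of_smul hw)) ?_
        rw [dist_eq_norm, show z - (z - τ • ι - w) = τ • ι + w by abel]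
        have := min_le_left r r₁
        linarith [norm_add_le (τ • ι) w]
      have hpos : ∀ z, 0 ≤ φ j (z - τ • ι) := fun z => by
        simp only [φ, convolution_lsmul]
        exact integral_nonneg fun w => mul_nonneg ((bump (𝔼 × ℝ) j).nonneg_normed w) (hψ0 _)
      have hs := hsub _ htest hpos
      have hd1 : ∀ z, fderiv ℝ (fun z => φ j (z - τ • ι)) z ι
          = fderiv ℝ (φ j) (z - τ • ι) ι := fun z => by rw [fderiv_comp_sub]
      have hd2 : ∀ z, spaceGradient (fun z => φ j (z - τ • ι)) z
          = spaceGradient (φ j) (z - τ • ι) := fun z => spaceGradient_comp_sub _ _ _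
      simp only [hd1, hd2] at hs
      have hφt : Continuous fun z => fderiv ℝ (φ j) z ι :=
        ((hφs j).continuous_fderiv (by simp)).clm_apply continuous_const
      obtain ⟨C₁, hC₁⟩ := ((hφc j).fderiv_apply (𝕜 := ℝ) ι).exists_bound_of_continuous hφt
      obtain ⟨C₂, hC₂⟩ := (hasCompactSupport_spaceGradient (hφc j)).exists_bound_of_continuous
        (continuous_spaceGradient (hφs j))
      have hi1 : Integrable fun z => v z * fderiv ℝ (φ j) (z - τ • ι) ι :=
        hvi.mul_bdd (c := C₁) (hφt.comp (by fun_prop)).aestronglyMeasurable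
          (Eventually.of_forall fun z => hC₁ _)
      have hi2 : Integrable fun z => (inner ℝ (A z) (spaceGradient (φ j) (z - τ • ι)) : ℝ) := by
        refine (hAi.norm.mul_const C₂).mono' (hAi.aestronglyMeasurable.inner
          ((continuous_spaceGradient (hφs j)).comp (by fun_prop)).aestronglyMeasurable)
          (Eventually.of_forall fun z => (norm_inner_le_norm _ _).trans ?_)
        gcongr
        exact hC₂ _
      have hadd : ∫ z, (-(v z * fderiv ℝ (φ j) (z - τ • ι) ι)
            + inner ℝ (A z) (spaceGradient (φ j) (z - τ • ι)))
          = -(∫ z, v z * fderiv ℝ (φ j) (z - τ • ι) ι)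
            + ∫ z, inner ℝ (A z) (spaceGradient (φ j) (z - τ • ι)) := by
        rw [← integral_neg]
        exact integral_add hi1.neg hi2
      rw [hadd, hEφ] at hs
      have hEge : E 0 - κ ≤ ∫ w, ρ j w * E (w + τ • ι) := by
        have hone : ∫ w, ρ j w * (E 0 - κ) = E 0 - κ := by
          rw [integral_mul_const, (bump (𝔼 × ℝ) j).integral_normed, one_mul]
        rw [← hone]
        refine integral_mono ?_ ?_ fun w => ?_
        · exact ((hρ j).continuous.integrable_of_hasCompactSupport (hρc j)).mul_const _
        · exact ((hρ j).continuous.mul (hEc.comp (by fun_prop))).integrable_of_hasCompactSupport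
            (hρc j).mul_right
        · by_cases hw : ρ j w = 0
          · simp [hw]
          · refine mul_le_mul_of_nonneg_left ?_ ((bump (𝔼 × ℝ) j).nonneg_normed w)
            refine (hr₁E _ ?_).le
            rw [mem_ball_zero_iff]
            have := min_le_right r r₁
            linarith [norm_add_le w (τ • ι), hρ0 w hw]
      linarith
    -- Mean value inequality in the shift parameter on [-h, 0].
    have := (convex_Icc (-h) 0).image_sub_le_mul_sub_of_deriv_le
      (fun τ _ => (hderiv τ).continuousAt.continuousWithinAt)
      (fun τ _ => (hderiv τ).differentiableAt.differentiableWithinAt)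
      (fun τ hτ => (hderiv τ).deriv.trans_le (hle τ (interior_subset hτ)))
      (-h) ⟨le_rfl, by linarith⟩ 0 ⟨by linarith, le_rfl⟩ (by linarith)
    simpa using this
  have hfin := le_of_tendsto ((hlim ((0 : ℝ) • ι)).sub (hlim ((-h) • ι))) hstep
  simpa only [hV, hE0, zero_smul, sub_zero] using hfin

end SpaceTime

/-! ### Testing with the cutoff, and passage to the limit. -/

section Subsolution

variable {n : ℕ}

local notation "𝔼" => EuclideanSpace ℝ (Fin n)

theorem fderiv_eq_zero_of_notMem_tsupport {φ : 𝔼 × ℝ → ℝ} {z : 𝔼 × ℝ} (hz : z ∉ tsupport φ) :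
    fderiv ℝ φ z = 0 := by
  by_contra h0
  exact hz (support_fderiv_subset ℝ h0)

theorem setIntegral_weakForm_eq {p : ℝ} {Ω : Set 𝔼} {T : ℝ} (u : 𝔼 × ℝ → ℝ) (Du : 𝔼 × ℝ → 𝔼)
    {φ : 𝔼 × ℝ → ℝ} (hφ : IsTestFunction (cylinder Ω T) φ) :
    ∫ z in cylinder Ω T, (-(|u z| ^ (p - 2) * u z * deriv (fun s => φ (z.1, s)) z.2)
          + inner ℝ (‖Du z‖ ^ (p - 2) • Du z) (gradient (fun y => φ (y, z.2)) z.1))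
      = ∫ z, (-(signedPow p (u z) * fderiv ℝ φ z (0, 1))
          + inner ℝ (‖Du z‖ ^ (p - 2) • Du z) (spaceGradient φ z)) := by
  have hd := hφ.smooth.differentiable (by simp)
  simp only [deriv_slice hd, gradient_slice hd]
  refine setIntegral_eq_integral_of_forall_compl_eq_zero fun z hz => ?_
  have hz' : z ∉ tsupport φ := fun h => hz (hφ.tsupport_subset h)
  simp [fderiv_eq_zero_of_notMem_tsupport hz', spaceGradient_eq_zero hz']

theorem integrable_of_memLp_of_support_subset {F : Type*} [NormedAddCommGroup F] {q : ENNReal}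
    (hq : 1 ≤ q) {Q : Set (𝔼 × ℝ)} (hQ : IsCompact Q) {h : 𝔼 × ℝ → F} (hh : MemLp h q)
    (hs : Function.support h ⊆ Q) : Integrable h := by
  have : IsFiniteMeasure ((volume : Measure (𝔼 × ℝ)).restrict Q) :=
    ⟨by simpa using hQ.measure_lt_top⟩
  exact (integrableOn_iff_integrable_of_support_subset hs).1 ((hh.restrict Q).integrable hq)

/-- The inequality obtained by testing with `η * cutoff p c j u`. -/
theorem integral_cutoff_le_zero {p c : ℝ} (hp : 1 < p) (hc : 0 < c) {Ω : Set 𝔼} (hΩ : IsOpen Ω)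
    {T : ℝ} {u : 𝔼 × ℝ → ℝ} {Du : 𝔼 × ℝ → 𝔼}
    (hu : ∀ᵐ t ∂(volume.restrict (Ioo 0 T)),
      HasWeakGradientOn Ω (fun x => u (x, t)) (fun x => Du (x, t)))
    {η : 𝔼 × ℝ → ℝ} (hη : IsTestFunction (cylinder Ω T) η) (hη0 : ∀ z, 0 ≤ η z)
    {Q : Set (𝔼 × ℝ)} (hQ : IsCompact Q) {r : ℝ} (hr : 0 < r)
    (hrQ : Metric.cthickening r (tsupport η) ⊆ Q) {w : 𝔼 × ℝ → ℝ} {D : 𝔼 × ℝ → 𝔼}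
    (hw : w = Q.indicator u) (hD : D = Q.indicator Du)
    (hwp : MemLp w (ENNReal.ofReal p)) (hDp : MemLp D (ENNReal.ofReal p))
    (hsub : ∀ φ : 𝔼 × ℝ → ℝ, IsTestFunction Q φ → (∀ z, 0 ≤ φ z) →
      ∫ z, (-(signedPow p (w z) * fderiv ℝ φ z (0, 1))
          + inner ℝ (‖D z‖ ^ (p - 2) • D z) (spaceGradient φ z)) ≤ 0) (j : ℕ) :
    ∫ z, (-(softPosPart (signedPow p c) j (signedPow p (w z)) * fderiv ℝ η z (0, 1))
          + cutoff p c j (w z) * inner ℝ (‖D z‖ ^ (p - 2) • D z) (spaceGradient η z)) ≤ 0 := by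
  -- The conjugate exponent comes first: v and the flux lie in L^{p'}, while the test function and
  -- its gradient lie in L^p.
  have hpq := (Real.HolderConjugate.conjExponent hp).symm
  have hηQ : tsupport η ⊆ Q := (Metric.self_subset_cthickening _).trans hrQ
  have hηs := hη.smooth
  have hηc := hη.hasCompactSupport
  set k := signedPow p c with hk
  have hk0 : 0 ≤ k := by rw [hk, signedPow_of_nonneg hp hc.le]; positivity
  set ι : 𝔼 × ℝ := (0, 1) with hι
  set v : 𝔼 × ℝ → ℝ := fun z => signedPow p (w z) with hv
  set A : 𝔼 × ℝ → 𝔼 := fun z => ‖D z‖ ^ (p - 2) • D z with hA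
  set ζ := cutoff p c j with hζ
  have hζ1 : ContDiff ℝ 1 ζ := contDiff_cutoff hp hc j
  obtain ⟨C, hC⟩ := exists_bound_deriv_cutoff hp hc j
  have hwm := hwp.aestronglyMeasurable
  have hDm := hDp.aestronglyMeasurable
  have hζn : ∀ s, ‖ζ s‖ ≤ 1 := fun s => by
    rw [Real.norm_of_nonneg (cutoff_nonneg _ _ _ _)]; exact cutoff_le_one _ _ _ _
  have hζw : AEStronglyMeasurable (fun z => ζ (w z)) :=
    hζ1.continuous.comp_aestronglyMeasurable hwm
  have hζ'w : AEStronglyMeasurable (fun z => deriv ζ (w z)) :=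
    (hζ1.continuous_deriv le_rfl).comp_aestronglyMeasurable hwm
  have hvm : AEStronglyMeasurable v :=
    ((measurable_signedPow p).comp_aemeasurable hwm.aemeasurable).aestronglyMeasurable
  have hAm : AEStronglyMeasurable A :=
    (hDm.norm.aemeasurable.pow_const _).aestronglyMeasurable.smul hDm
  have hvp : MemLp v (ENNReal.ofReal p.conjExponent) :=
    memLp_of_norm_eq_rpow hp hwp hvm fun z => norm_signedPow hp _
  have hAp : MemLp A (ENNReal.ofReal p.conjExponent) :=
    memLp_of_norm_eq_rpow hp hDp hAm fun z => norm_rpow_smul_self hp _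
  have hq1 : 1 ≤ ENNReal.ofReal p.conjExponent := by simpa using hpq.lt.le
  have hp1 : 1 ≤ ENNReal.ofReal p := by simpa using hp.le
  have hvi : Integrable v := integrable_of_memLp_of_support_subset hq1 hQ hvp fun z hz => by
    by_contra h
    exact hz (by simp [hv, hw, indicator_of_notMem h, signedPow_zero])
  have hAi : Integrable A := integrable_of_memLp_of_support_subset hq1 hQ hAp fun z hz => by
    by_contra h
    exact hz (by simp [hA, hD, indicator_of_notMem h])
  set ψ : 𝔼 × ℝ → ℝ := fun z => η z * ζ (w z) with hψ
  set Dψ : 𝔼 × ℝ → 𝔼 := fun z =>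
    ζ (w z) • spaceGradient η z + (η z * deriv ζ (w z)) • D z with hDψ
  obtain ⟨C₀, hC₀⟩ := hηc.exists_bound_of_continuous hηs.continuous
  have hηt : Continuous fun z => fderiv ℝ η z ι := hη.continuous_fderiv_apply ι
  obtain ⟨C₁, hC₁⟩ := (hη.hasCompactSupport_fderiv_apply ι).exists_bound_of_continuous hηt
  have hgc := continuous_spaceGradient hηs
  have hgs := hasCompactSupport_spaceGradient hηc
  obtain ⟨C₂, hC₂⟩ := hgs.exists_bound_of_continuous hgc
  have hψm : AEStronglyMeasurable ψ := hηs.continuous.aestronglyMeasurable.mul hζw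
  have hψle : ∀ z, ‖ψ z‖ ≤ ‖η z‖ := fun z => by
    rw [hψ, norm_mul]
    exact mul_le_of_le_one_right (norm_nonneg _) (hζn _)
  have hψsupp : Function.support ψ ⊆ tsupport η := fun z hz =>
    subset_tsupport η (left_ne_zero_of_mul hz)
  have hψts : tsupport ψ ⊆ tsupport η := closure_minimal hψsupp (isClosed_tsupport η)
  have hψp : MemLp ψ (ENNReal.ofReal p) :=
    (hηs.continuous.memLp_of_hasCompactSupport hηc).mono hψm (Eventually.of_forall hψle)
  have hψi : Integrable ψ :=
    integrable_of_memLp_of_support_subset hp1 hQ hψp (hψsupp.trans hηQ)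
  have hDψp : MemLp Dψ (ENNReal.ofReal p) := by
    refine MemLp.add ?_ ?_
    · refine (hgc.memLp_of_hasCompactSupport hgs).mono
        (hζw.smul hgc.aestronglyMeasurable) (Eventually.of_forall fun z => ?_)
      rw [norm_smul]
      exact mul_le_of_le_one_left (norm_nonneg _) (hζn _)
    · refine hDp.of_le_mul (c := C₀ * C)
        ((hηs.continuous.aestronglyMeasurable.mul hζ'w).smul hDm)
        (Eventually.of_forall fun z => ?_)
      rw [norm_smul, norm_mul]
      have hC0 : 0 ≤ C₀ := (norm_nonneg _).trans (hC₀ 0)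
      gcongr
      · exact hC₀ z
      · exact hC _
  have hDψi : Integrable Dψ := by
    refine integrable_of_memLp_of_support_subset hp1 hQ hDψp fun z hz => ?_
    by_contra h
    have hz' : z ∉ tsupport η := fun h' => h (hηQ h')
    exact hz (by simp [hDψ, spaceGradient_eq_zero hz', image_eq_zero_of_notMem_tsupport hz'])
  have hψu : ∀ z, ψ z = η z * ζ (u z) := fun z => by
    by_cases hz : z ∈ Q
    · simp [hψ, hw, indicator_of_mem hz]
    · simp [hψ, image_eq_zero_of_notMem_tsupport fun h' => hz (hηQ h')]
  have hDψu : ∀ z, Dψ z = ζ (u z) • spaceGradient η z + (η z * deriv ζ (u z)) • Du z := fun z => by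
    by_cases hz : z ∈ Q
    · simp [hDψ, hw, hD, indicator_of_mem hz]
    · have hz' : z ∉ tsupport η := fun h' => hz (hηQ h')
      simp [hDψ, spaceGradient_eq_zero hz', image_eq_zero_of_notMem_tsupport hz']
  have hψ0 : ∀ z, 0 ≤ ψ z := fun z => mul_nonneg (hη0 z) (cutoff_nonneg _ _ _ _)
  have hψcs : HasCompactSupport ψ := hηc.of_isClosed_subset (isClosed_tsupport _) hψts
  have hmain := fun {κ : ℝ} (hκ : 0 < κ) => exists_translate_sub_le hpq hvp hvi hAp hAi hψp hψi
    hDψp hDψi (fun θ hθ hθc e => integral_mul_comp_mul_fderiv_eq hΩ hu hη hζ1 hC hψu hDψu hψi hDψi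
      hθ hθc e) hψ0 hr hψcs ((Metric.cthickening_subset_of_subset r hψts).trans hrQ) hsub hκ
  set Γ : 𝔼 × ℝ → ℝ := fun z => softPosPart k j (v z) with hΓ
  have hΓi : Integrable Γ := by
    refine hvi.mono ?_ (Eventually.of_forall fun z => abs_softPosPart_le hk0 j _)
    exact ((monotone_softPosPart k j).measurable.comp_aemeasurable
      hvm.aemeasurable).aestronglyMeasurable
  -- Shifting variables puts the difference on v and on `Γ`; convexity then compares the two
  -- pointwise, with weight η ≥ 0.
  have hconv : ∀ h : ℝ, (∫ z, Γ z * η (z - (0 : ℝ) • ι)) - ∫ z, Γ z * η (z - (-h) • ι)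
      ≤ (∫ z, v z * ψ z) - ∫ z, v z * ψ (z - (-h) • ι) := by
    intro h
    have hshift : ∀ f g : 𝔼 × ℝ → ℝ,
        ∫ z, f z * g (z - (-h) • ι) = ∫ z, f (z - h • ι) * g z := fun f g => by
      rw [← integral_sub_right_eq_self _ (h • ι)]
      refine integral_congr_ae (Eventually.of_forall fun z => ?_)
      simp
    have hψb : ∀ z, ‖ψ z‖ ≤ C₀ := fun z => (hψle z).trans (hC₀ z)
    have hi1 := hΓi.mul_bdd (c := C₀) hηs.continuous.aestronglyMeasurable (Eventually.of_forall hC₀)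
    have hi2 := (hΓi.comp_sub_right (h • ι)).mul_bdd (c := C₀)
      hηs.continuous.aestronglyMeasurable (Eventually.of_forall hC₀)
    have hi3 := hvi.mul_bdd (c := C₀) hψm (Eventually.of_forall hψb)
    have hi4 := (hvi.comp_sub_right (h • ι)).mul_bdd (c := C₀) hψm (Eventually.of_forall hψb)
    rw [hshift, hshift]
    simp only [zero_smul, sub_zero]
    rw [← integral_sub hi1 hi2, ← integral_sub hi3 hi4]
    refine integral_mono (hi1.sub hi2) (hi3.sub hi4) fun z => ?_
    have h1 := mul_le_mul_of_nonneg_left (softPosPart_sub_le k j (v (z - h • ι)) (v z)) (hη0 z)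
    calc Γ z * η z - Γ (z - h • ι) * η z
        = η z * (softPosPart k j (v z) - softPosPart k j (v (z - h • ι))) := by
          simp only [hΓ]; ring
      _ ≤ _ := h1
      _ = v z * ψ z - v (z - h • ι) * ψ z := by
          simp only [hψ, hζ, cutoff, ← hk, hv]; ring
  set E := ∫ z, inner ℝ (A z) (Dψ z) with hE
  have hH := hasDerivAt_integral_mul_translate hΓi hηs hηc ι 0
  -- The slope at 0 from the left, with t = -h, is at most -(E - κ) for small h. Its limit exists
  -- because η is smooth, and κ is arbitrary.
  have hHle : -∫ z, Γ z * fderiv ℝ η (z - (0 : ℝ) • ι) ι ≤ -E := by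
    refine le_of_forall_pos_le_add fun κ hκ => ?_
    obtain ⟨h₀, hh₀, hmain⟩ := hmain hκ
    have hsl := hH.tendsto_slope_zero_left
    refine le_of_tendsto hsl ?_
    filter_upwards [Ioo_mem_nhdsLT (neg_lt_zero.2 hh₀)] with t ht
    have h1 := (hconv (-t)).trans (hmain (-t) (by linarith [ht.2]) (by linarith [ht.1]))
    rw [neg_neg] at h1
    rw [zero_add, smul_eq_mul]
    have ht0 : t < 0 := ht.2
    rw [← neg_le_neg_iff, ← neg_mul, neg_mul, ← mul_neg, neg_sub, inv_mul_eq_div,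
      le_div_iff_of_neg ht0]
    linarith
  have hgi : Integrable fun z => ζ (w z) * (inner ℝ (A z) (spaceGradient η z) : ℝ) := by
    refine (hAi.norm.mul_const C₂).mono' (hζw.mul
      (hAm.inner hgc.aestronglyMeasurable)) (Eventually.of_forall fun z => ?_)
    rw [norm_mul]
    refine (mul_le_of_le_one_left (norm_nonneg _) (hζn _)).trans
      ((norm_inner_le_norm _ _).trans ?_)
    gcongr
    exact hC₂ z
  have hEi : Integrable fun z => (inner ℝ (A z) (Dψ z) : ℝ) := by
    have : (ENNReal.ofReal p.conjExponent).HolderConjugate (ENNReal.ofReal p) := hpq.ennrealOfReal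
    exact (hAp.norm.integrable_mul hDψp.norm).mono' (hAm.inner hDψp.aestronglyMeasurable)
      (Eventually.of_forall fun z => norm_inner_le_norm _ _)
  -- The discarded term is η times the derivative of the cutoff times |D|^p, all nonnegative.
  have hEge : ∫ z, ζ (w z) * inner ℝ (A z) (spaceGradient η z) ≤ E := by
    refine integral_mono hgi hEi fun z => ?_
    simp only [hDψ, inner_add_right, inner_smul_right]
    refine le_add_of_nonneg_right (mul_nonneg (mul_nonneg (hη0 z) (deriv_cutoff_nonneg hp c j _)) ?_)
    simp only [hA, real_inner_smul_left]
    exact mul_nonneg (by positivity) real_inner_self_nonneg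
  have hΓt : Integrable fun z => Γ z * fderiv ℝ η z ι :=
    hΓi.mul_bdd (c := C₁) hηt.aestronglyMeasurable (Eventually.of_forall hC₁)
  have hadd : ∫ z, (-(Γ z * fderiv ℝ η z ι) + ζ (w z) * inner ℝ (A z) (spaceGradient η z))
      = -(∫ z, Γ z * fderiv ℝ η z ι) + ∫ z, ζ (w z) * inner ℝ (A z) (spaceGradient η z) := by
    rw [← integral_neg]
    exact integral_add hΓt.neg hgi
  simp only [zero_smul, sub_zero] at hHle
  refine hadd.trans_le ?_
  linarith

/-- Integration by parts against the constant 1. It allows the constant k to be restored in the time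
term. -/
theorem integral_fderiv_apply_eq_zero {U : Set (𝔼 × ℝ)} {η : 𝔼 × ℝ → ℝ} (hη : IsTestFunction U η)
    (v : 𝔼 × ℝ) : ∫ z, fderiv ℝ η z v = 0 := by
  have hi := (hη.continuous_fderiv_apply v).integrable_of_hasCompactSupport (μ := volume)
    (hη.hasCompactSupport_fderiv_apply v)
  have h := integral_mul_fderiv_eq_neg_fderiv_mul_of_integrable (μ := (volume : Measure (𝔼 × ℝ)))
    (f := fun _ => (1 : ℝ)) (g := η) (v := v) (by simp) (by simpa using hi)
    (by simpa using hη.smooth.continuous.integrable_of_hasCompactSupport hη.hasCompactSupport)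
    (fun x _ => differentiableAt_const _) (fun x _ => (hη.smooth.differentiable (by simp)) x)
  simpa using h

theorem MemParabolicSobolevLoc.max_const {p : ℝ} {Ω : Set 𝔼} (hΩ : IsOpen Ω) {T : ℝ}
    {u : 𝔼 × ℝ → ℝ} {Du : 𝔼 × ℝ → 𝔼} (h : MemParabolicSobolevLoc p Ω T u Du) (c : ℝ) :
    MemParabolicSobolevLoc p Ω T (fun z => max (u z) c)
      (fun z => (if c < u z then 1 else 0 : ℝ) • Du z) where
  hasWeakGradientOn := by
    filter_upwards [h.hasWeakGradientOn] with t ht using ht.max_const hΩ c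
  memLp K hK hKΩ t₁ t₂ ht₁ ht₂ := by
    have : IsFiniteMeasure ((volume : Measure (𝔼 × ℝ)).restrict (K ×ˢ Icc t₁ t₂)) :=
      ⟨by simpa using (hK.prod isCompact_Icc).measure_lt_top⟩
    exact (h.memLp K hK hKΩ t₁ t₂ ht₁ ht₂).sup (memLp_const c)
  memLp_grad K hK hKΩ t₁ t₂ ht₁ ht₂ := by
    have h1 := h.memLp_grad K hK hKΩ t₁ t₂ ht₁ ht₂
    have hm : Measurable fun s : ℝ => (if c < s then 1 else 0 : ℝ) :=
      Measurable.ite measurableSet_Ioi measurable_const measurable_const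
    refine h1.mono ((hm.comp_aemeasurable (h.memLp K hK hKΩ t₁ t₂ ht₁
      ht₂).aestronglyMeasurable.aemeasurable).aestronglyMeasurable.smul h1.aestronglyMeasurable)
      (Eventually.of_forall fun z => ?_)
    split_ifs <;> simp

theorem IsWeakSubsolution.max_const {p c : ℝ} (hp : 1 < p) (hc : 0 < c) {Ω : Set 𝔼}
    (hΩ : IsOpen Ω) {T : ℝ} {u : 𝔼 × ℝ → ℝ} (hu : IsWeakSubsolution p Ω T u) :
    IsWeakSubsolution p Ω T (fun z => max (u z) c) := by
  obtain ⟨Du, hmem, hineq⟩ := hu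
  refine ⟨_, hmem.max_const hΩ c, fun η hη hη0 => ?_⟩
  rw [setIntegral_weakForm_eq _ _ hη]
  have hcyl : IsOpen (cylinder Ω T) := hΩ.prod isOpen_Ioo
  obtain ⟨r, hr, hrΩ⟩ := hη.hasCompactSupport.isCompact.exists_cthickening_subset_open hcyl
    hη.tsupport_subset
  set Q := Metric.cthickening r (tsupport η) with hQdef
  have hQ : IsCompact Q := hη.hasCompactSupport.isCompact.cthickening
  have hηQ : tsupport η ⊆ Q := Metric.self_subset_cthickening _
  set w := Q.indicator u with hw
  set D := Q.indicator Du with hD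
  have hwp : MemLp w (ENNReal.ofReal p) :=
    (memLp_indicator_iff_restrict hQ.measurableSet).2
      (memLp_restrict_of_isCompact hmem.memLp hQ hrΩ)
  have hDp : MemLp D (ENNReal.ofReal p) :=
    (memLp_indicator_iff_restrict hQ.measurableSet).2
      (memLp_restrict_of_isCompact hmem.memLp_grad hQ hrΩ)
  have hsub : ∀ φ : 𝔼 × ℝ → ℝ, IsTestFunction Q φ → (∀ z, 0 ≤ φ z) →
      ∫ z, (-(signedPow p (w z) * fderiv ℝ φ z (0, 1))
          + inner ℝ (‖D z‖ ^ (p - 2) • D z) (spaceGradient φ z)) ≤ 0 := by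
    intro φ hφ hφ0
    have hφ' : IsTestFunction (cylinder Ω T) φ :=
      ⟨hφ.smooth, hφ.hasCompactSupport, hφ.tsupport_subset.trans hrΩ⟩
    have h1 := hineq φ hφ' hφ0
    rw [setIntegral_weakForm_eq _ _ hφ'] at h1
    refine le_of_eq_of_le (integral_congr_ae (Eventually.of_forall fun z => ?_)) h1
    by_cases hz : z ∈ Q
    · simp [hw, hD, indicator_of_mem hz]
    · have hz' : z ∉ tsupport φ := fun h => hz (hφ.tsupport_subset h)
      simp [fderiv_eq_zero_of_notMem_tsupport hz', spaceGradient_eq_zero hz']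
  have hcut := integral_cutoff_le_zero hp hc hΩ hmem.hasWeakGradientOn hη hη0 hQ hr le_rfl hw hD
    hwp hDp hsub
  set k := signedPow p c with hk
  have hk0 : 0 ≤ k := by rw [hk, signedPow_of_nonneg hp hc.le]; positivity
  have hpq := (Real.HolderConjugate.conjExponent hp).symm
  have hq1 : 1 ≤ ENNReal.ofReal p.conjExponent := by simpa using hpq.lt.le
  have hwm := hwp.aestronglyMeasurable
  have hDm := hDp.aestronglyMeasurable
  have hvm : AEStronglyMeasurable fun z => signedPow p (w z) :=
    ((measurable_signedPow p).comp_aemeasurable hwm.aemeasurable).aestronglyMeasurable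
  have hAm : AEStronglyMeasurable fun z => ‖D z‖ ^ (p - 2) • D z :=
    (hDm.norm.aemeasurable.pow_const _).aestronglyMeasurable.smul hDm
  have hvi : Integrable fun z => signedPow p (w z) := by
    refine integrable_of_memLp_of_support_subset hq1 hQ
      (memLp_of_norm_eq_rpow hp hwp hvm fun z => norm_signedPow hp _) fun z hz => ?_
    by_contra h
    exact hz (by simp [hw, indicator_of_notMem h, signedPow_zero])
  have hAi : Integrable fun z => ‖D z‖ ^ (p - 2) • D z := by
    refine integrable_of_memLp_of_support_subset hq1 hQ
      (memLp_of_norm_eq_rpow hp hDp hAm fun z => norm_rpow_smul_self hp _) fun z hz => ?_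
    by_contra h
    exact hz (by simp [hD, indicator_of_notMem h])
  have hηt := hη.continuous_fderiv_apply (0, 1)
  obtain ⟨C₁, hC₁⟩ := (hη.hasCompactSupport_fderiv_apply (0, 1)).exists_bound_of_continuous hηt
  have hgc := continuous_spaceGradient hη.smooth
  obtain ⟨C₂, hC₂⟩ :=
    (hasCompactSupport_spaceGradient hη.hasCompactSupport).exists_bound_of_continuous hgc
  have hvt : Integrable fun z => signedPow p (w z) * fderiv ℝ η z (0, 1) :=
    hvi.mul_bdd (c := C₁) hηt.aestronglyMeasurable (Eventually.of_forall hC₁)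
  have hAg : Integrable fun z =>
      (inner ℝ (‖D z‖ ^ (p - 2) • D z) (spaceGradient η z) : ℝ) := by
    refine (hAi.norm.mul_const C₂).mono' (hAm.inner hgc.aestronglyMeasurable)
      (Eventually.of_forall fun z => (norm_inner_le_norm _ _).trans ?_)
    gcongr
    exact hC₂ z
  set Y : ℕ → 𝔼 × ℝ → ℝ := fun j z =>
    -(softPosPart k j (signedPow p (w z)) * fderiv ℝ η z (0, 1))
      + cutoff p c j (w z) * inner ℝ (‖D z‖ ^ (p - 2) • D z) (spaceGradient η z) with hY
  -- The pointwise limit of `Y`. Domination is uniform in j because the primitive is bounded by |v|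
  -- and the cutoff by 1.
  set Z : 𝔼 × ℝ → ℝ := fun z => -((max (signedPow p (w z)) k - k) * fderiv ℝ η z (0, 1))
      + (if c < w z then 1 else 0 : ℝ)
        * inner ℝ (‖D z‖ ^ (p - 2) • D z) (spaceGradient η z) with hZ
  have hYm : ∀ j, AEStronglyMeasurable (Y j) := fun j => by
    refine AEStronglyMeasurable.add (AEStronglyMeasurable.neg ?_) ?_
    · exact ((monotone_softPosPart k j).measurable.comp_aemeasurable
        hvm.aemeasurable).aestronglyMeasurable.mul hηt.aestronglyMeasurable
    · exact ((contDiff_cutoff hp hc j).continuous.comp_aestronglyMeasurable hwm).mul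
        hAg.aestronglyMeasurable
  have hYlim : ∀ z, Tendsto (fun j => Y j z) atTop (𝓝 (Z z)) := fun z =>
    ((tendsto_softPosPart k _).mul_const _).neg.add ((tendsto_cutoff hp c (w z)).mul_const _)
  have hbound : Integrable fun z => ‖signedPow p (w z) * fderiv ℝ η z (0, 1)‖
      + ‖(inner ℝ (‖D z‖ ^ (p - 2) • D z) (spaceGradient η z) : ℝ)‖ := hvt.norm.add hAg.norm
  have hYle : ∀ j z, ‖Y j z‖ ≤ ‖signedPow p (w z) * fderiv ℝ η z (0, 1)‖
      + ‖(inner ℝ (‖D z‖ ^ (p - 2) • D z) (spaceGradient η z) : ℝ)‖ := fun j z => by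
    refine (norm_add_le _ _).trans (add_le_add ?_ ?_)
    · rw [norm_neg, norm_mul, norm_mul]
      gcongr
      exact abs_softPosPart_le hk0 j _
    · rw [norm_mul, Real.norm_of_nonneg (cutoff_nonneg _ _ _ _)]
      exact mul_le_of_le_one_left (norm_nonneg _) (cutoff_le_one _ _ _ _)
  have hZle : ∫ z, Z z ≤ 0 := le_of_tendsto
    (tendsto_integral_of_dominated_convergence _ hYm hbound
      (fun j => Eventually.of_forall (hYle j)) (Eventually.of_forall hYlim))
    (Eventually.of_forall hcut)
  have hZi : Integrable Z := by
    refine hbound.mono' (aestronglyMeasurable_of_tendsto_ae atTop hYm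
      (Eventually.of_forall hYlim)) (Eventually.of_forall fun z => ?_)
    exact le_of_tendsto (hYlim z).norm (Eventually.of_forall fun j => hYle j z)
  have hki : Integrable fun z => k * fderiv ℝ η z (0, 1) :=
    ((hη.continuous_fderiv_apply (0, 1)).integrable_of_hasCompactSupport
      (hη.hasCompactSupport_fderiv_apply (0, 1))).const_mul k
  have hki0 : ∫ z, k * fderiv ℝ η z (0, 1) = 0 := by
    rw [integral_const_mul, integral_fderiv_apply_eq_zero hη, mul_zero]
  have hfin : ∫ z, (Z z - k * fderiv ℝ η z (0, 1)) ≤ 0 := by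
    rw [integral_sub hZi hki, hki0, sub_zero]
    exact hZle
  refine le_of_eq_of_le (integral_congr_ae (Eventually.of_forall fun z => ?_)) hfin
  by_cases hz : z ∈ Q
  -- Monotonicity of the signed power commutes it with the maximum; subtracting the null term in k
  -- turns (v - k)_+ into the signed power of max(u, c).
  · have hmax : signedPow p (max (u z) c) = max (signedPow p (u z)) k :=
      (strictMono_signedPow hp).monotone.map_max
    simp only [hZ, hw, hD, indicator_of_mem hz, hmax]
    split_ifs with h
    · simp only [one_smul, one_mul]; ring
    · simp only [zero_smul, smul_zero, inner_zero_left, zero_mul]; ring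
  · have hz' : z ∉ tsupport η := fun h => hz (hηQ h)
    simp [hZ, fderiv_eq_zero_of_notMem_tsupport hz', spaceGradient_eq_zero hz']

end Subsolution

end Trudinger

theorem mainTheorem10 {n : ℕ} (Ω : Set (EuclideanSpace ℝ (Fin n))) (hΩ : IsOpen Ω)
    (T p c : ℝ) (hp : 1 < p) (hc : 0 < c)
    (u : EuclideanSpace ℝ (Fin n) × ℝ → ℝ)
    (hu : Trudinger.IsWeakSubsolution p Ω T u)
    (hu_nonneg : ∀ᵐ z ∂(volume.restrict (Trudinger.cylinder Ω T)), 0 ≤ u z)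
    (hu_cont : p < 2 → ContinuousOn u (Trudinger.cylinder Ω T)) :
    Trudinger.IsWeakSubsolution p Ω T (fun z => max (u z) c) :=
  hu.max_const hp hc hΩ
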